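/- Let $\mathbb N=\{1,2,\dots\}$ and let $b=(b_k)_{k\ge1}$, $\omega=(\omega_k)_{k\ge1}$ be real sequences satisfying (A1) $\sum_k b_k^2<\infty$ and $b_k\ne0$ for all $k$; (A2) $\omega_1>0$ and there is $\omega_*>0$ with $\omega_{k+1}-\omega_k\ge\omega_*$ for all $k$; (A4) $\displaystyle\sum_{k\ge1}\sum_{j\ne k}\frac{b_j^2}{(\omega_j-\omega_k)^2}<\infty$; (A5) for a given $\rho>0$, $\displaystyle\sum_{k\ge1}\frac1{|b_k|^{2\rho}}\sum_{j\ne k}\frac{|b_j|^{2(1+\rho)}}{(\omega_j-\omega_k)^2}<\infty$. Let $X=\ell^2(\mathbb C)^4$, with elements written $\theta=(z,\zeta,p,q)$, and for $\gamma\in\mathbb R$ let $V^X_{0,\gamma}$ be the Hilbert space of all quadruples $\theta=(z,\zeta,p,q)$ of complex sequences with $$\|\theta\|_{V^X_{0,\gamma}}^2=\sum_{k\ge1}\frac{|z_k|^2+|\zeta_k|^2+|p_k|^2+|q_k|^2}{|b_k|^{2\gamma}}<\infty .$$ Let $\mathcal A$ be the operator on $X$ with domain $D(\mathcal A)=\{\theta\in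 X:\sum_k\omega_k^2(|z_k|^2+|\zeta_k|^2+|p_k|^2+|q_k|^2)<\infty\}$ that maps $(z,\zeta,p,q)$ to the element of $X$ with coordinates $$-i\omega_kz_k+b_k\phi,\quad i\omega_k\zeta_k-b_k\phi,\quad z_k-i\omega_kp_k,\quad \zeta_k+i\omega_kq_k,\qquad \phi=\tfrac12\sum_jb_j(p_j-q_j).$$ Let $(\nu_k)_{k\ge1}$ be complex numbers that label eigenvalues of $\mathcal A$ in the following sense: the numbers $$\sigma_k^+=i\omega_k+\nu_k,\quad \sigma_k^-=i\omega_k-\overline{\nu_k},\quad \sigma_{-k}^+=-i\omega_k+\overline{\nu_k},\quad \sigma_{-k}^-=-i\omega_k-\nu_k\qquad(k\ge1)$$ are eigenvalues of $\mathcal A$, no number occurs twice in this list, and for all sufficiently large $k$ $$|\nu_k-\lambda_k^0|<\frac{\lambda_k^0}2,\qquad \lambda^0_k=\frac{|b_k|}{\sqrt{2+\frac{b_k^2}{4\omega_k^2}+2\sum_{j\ne k}\frac{b_j^2(\omega_k^2+\omega_j^2)}{(\omega_k^2-\omega_j^2)^2}}} .$$ For $\sigma\notin\{\pm i\omega_j\}$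 let $\theta(\sigma)\in X$ have the coordinates $$\frac{b_j}{\sigma+i\omega_j},\quad -\frac{b_j}{\sigma-i\omega_j},\quad \frac{b_j}{(\sigma+i\omega_j)^2},\quad -\frac{b_j}{(\sigma-i\omega_j)^2},$$ put $\theta_{k}^\pm=\theta(\sigma_k^\pm)$, $\theta_{-k}^\pm=\theta(\sigma_{-k}^\pm)$, and $$\theta_k^z=\frac{\overline{\nu_k}^2\theta_{-k}^+-\nu_k^2\theta_{-k}^-}{2b_k\operatorname{Re}\nu_k},\quad \theta_k^\zeta=-\frac{\nu_k^2\theta_k^+-\overline{\nu_k}^2\theta_k^-}{2b_k\operatorname{Re}\nu_k},\quad \theta_k^p=\frac{\overline{\nu_k}^2\theta_{-k}^++\nu_k^2\theta_{-k}^-}{2b_k},\quad \theta_k^q=-\frac{\nu_k^2\theta_k^++\overline{\nu_k}^2\theta_k^-}{2b_k}.$$ Then the synthesis operator $$\pi_0a=\sum_{k\ge1}\bigl(a_k^z\theta_k^z+a_k^\zeta\theta_k^\zeta+a_k^p\theta_k^p+a_k^q\theta_k^q\bigr),\qquad a=(a^z,a^\zeta,a^p,a^q)\in X,$$ where the series converges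 unconditionally in $X$, is a bounded bijection of $X$ onto $X$ with bounded inverse, $X\subset V^X_{0,-\rho}$, and $\pi_0$ extends to a bounded linear bijection of $V^X_{0,-\rho}$ onto itself with bounded inverse. -/

import Mathlib

open scoped ENNReal

noncomputable section

/-- Parameters of the oscillating system, with the two standing assumptions:
`b` is a square-summable real sequence without zero entries, and the frequencies `ω` are positive
with a uniform gap. The positive integers of the text are numbered from `0` here. -/
structure Oscillator where
  b : ℕ → ℝ
  ω : ℕ → ℝ
  summable_sq : Summable fun k => b k ^ 2
  b_ne_zero : ∀ k, b k ≠ 0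
  ω_pos : 0 < ω 0
  gap : ∃ ωs : ℝ, 0 < ωs ∧ ∀ k, ωs ≤ ω (k + 1) - ω k

/-- The Hilbert space `X = ℓ²(ℂ)⁴`, written as the space of square-summable sequences in `ℂ⁴`. For
`θ = (z, ζ, p, q)` the entries `θ k 0`, `θ k 1`, `θ k 2`, `θ k 3` are `z_k`, `ζ_k`, `p_k`, `q_k`. -/
abbrev StateSpace : Type := lp (fun _ : ℕ => EuclideanSpace ℂ (Fin 4)) 2

namespace Oscillator

variable (P : Oscillator)

/-- Assumption (A4). -/
def A4 : Prop :=
  Summable fun x : ℕ × ℕ =>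
    if x.2 = x.1 then 0 else P.b x.2 ^ 2 / (P.ω x.2 - P.ω x.1) ^ 2

/-- Assumption (A5) for the exponent `ρ`. -/
def A5 (ρ : ℝ) : Prop :=
  Summable fun x : ℕ × ℕ =>
    if x.2 = x.1 then 0
    else 1 / |P.b x.1| ^ (2 * ρ) * (|P.b x.2| ^ (2 * (1 + ρ)) / (P.ω x.2 - P.ω x.1) ^ 2)

/-! ### The weighted spaces -/

/-- The sequences `v = (z, ζ, p, q)` in `ℂ⁴` such that `v_k / |b_k| ^ γ` is square-summable. -/
def weightedSubmodule (γ : ℝ) : Submodule ℂ (ℕ → EuclideanSpace ℂ (Fin 4)) where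
  carrier := {v | Memℓp (fun k => ((|P.b k| ^ (-γ) : ℝ) : ℂ) • v k) 2}
  zero_mem' := by
    have h : Memℓp (0 : (k : ℕ) → EuclideanSpace ℂ (Fin 4)) 2 := zero_memℓp
    simpa [Pi.zero_def] using h
  add_mem' := by
    intro v w hv hw
    have h := Memℓp.add hv hw
    simpa [Pi.add_def, smul_add] using h
  smul_mem' := by
    intro c v hv
    have h := Memℓp.const_smul hv c
    simpa [Pi.smul_def, smul_comm c] using h

/-- The weighted space `V_{0,γ}^X`: all sequences of finite weighted norm, see `norm_sq`. -/
def WeightedSpace (γ : ℝ) : Type := P.weightedSubmodule γ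

namespace WeightedSpace

variable {P} {γ : ℝ}

instance : AddCommGroup (P.WeightedSpace γ) := inferInstanceAs (AddCommGroup (P.weightedSubmodule γ))

instance : Module ℂ (P.WeightedSpace γ) := inferInstanceAs (Module ℂ (P.weightedSubmodule γ))

/-- The underlying sequence in `ℂ⁴`. -/
def val (v : P.WeightedSpace γ) : ℕ → EuclideanSpace ℂ (Fin 4) := v.1

theorem memlp (v : P.WeightedSpace γ) :
    Memℓp (fun k => ((|P.b k| ^ (-γ) : ℝ) : ℂ) • v.val k) 2 := v.2

/-- The diagonal map `W_γ`, dividing the `k`-th entry by `|b_k| ^ γ`. -/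
def W : P.WeightedSpace γ →ₗ[ℂ] StateSpace where
  toFun v := ⟨fun k => ((|P.b k| ^ (-γ) : ℝ) : ℂ) • v.val k, v.memlp⟩
  map_add' v w := by
    ext k : 2
    exact smul_add _ (v.val k) (w.val k)
  map_smul' c v := by
    ext k : 2
    exact smul_comm _ c (v.val k)

theorem W_apply (v : P.WeightedSpace γ) (k : ℕ) :
    W v k = ((|P.b k| ^ (-γ) : ℝ) : ℂ) • v.val k := rfl

theorem W_injective : Function.Injective (W : P.WeightedSpace γ →ₗ[ℂ] StateSpace) := by
  intro v w h
  apply Subtype.ext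
  funext k
  have hk : W v k = W w k := by rw [h]
  rw [W_apply, W_apply] at hk
  have hne : ((|P.b k| ^ (-γ) : ℝ) : ℂ) ≠ 0 := by
    exact_mod_cast (Real.rpow_pos_of_pos (abs_pos.mpr (P.b_ne_zero k)) _).ne'
  exact smul_right_injective _ hne hk

instance : NormedAddCommGroup (P.WeightedSpace γ) :=
  NormedAddCommGroup.induced _ _ (W : P.WeightedSpace γ →ₗ[ℂ] StateSpace) W_injective

instance : NormedSpace ℂ (P.WeightedSpace γ) :=
  NormedSpace.induced ℂ _ _ (W : P.WeightedSpace γ →ₗ[ℂ] StateSpace)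

theorem norm_sq (v : P.WeightedSpace γ) :
    ‖v‖ ^ 2 = ∑' k, (‖v.val k 0‖ ^ 2 + ‖v.val k 1‖ ^ 2 + ‖v.val k 2‖ ^ 2 + ‖v.val k 3‖ ^ 2)
      / |P.b k| ^ (2 * γ) := by
  have h0 : ‖v‖ = ‖W v‖ := rfl
  have h := lp.norm_rpow_eq_tsum (p := 2) (by norm_num) (W v)
  simp only [ENNReal.toReal_ofNat, Real.rpow_two] at h
  rw [h0, h]
  refine tsum_congr fun k => ?_
  have hb : 0 < |P.b k| := abs_pos.mpr (P.b_ne_zero k)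
  have hr : (|P.b k| ^ (-γ)) ^ 2 = (|P.b k| ^ (2 * γ))⁻¹ := by
    rw [← Real.rpow_natCast, ← Real.rpow_mul hb.le, ← Real.rpow_neg hb.le]
    congr 1
    push_cast
    ring
  rw [W_apply, norm_smul, mul_pow, Complex.norm_real, Real.norm_eq_abs,
    abs_of_pos (Real.rpow_pos_of_pos hb _), hr, EuclideanSpace.norm_sq_eq, Fin.sum_univ_four,
    div_eq_inv_mul]

end WeightedSpace

/-! ### The operator `𝒜` and its eigenvalues -/

/-- The functional `φ = ½ b^*(p - q)`. -/
def phi (θ : StateSpace) : ℂ := 1 / 2 * ∑' j, (P.b j : ℂ) * (θ j 2 - θ j 3)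

/-- The domain of `𝒜`. -/
def domA : Set StateSpace := {θ | Summable fun k => P.ω k ^ 2 * ‖θ k‖ ^ 2}

/-- The entries of `𝒜 θ`. -/
def calA (θ : StateSpace) (k : ℕ) : EuclideanSpace ℂ (Fin 4) :=
  !₂[-Complex.I * P.ω k * θ k 0 + P.b k * P.phi θ,
    Complex.I * P.ω k * θ k 1 - P.b k * P.phi θ,
    θ k 0 - Complex.I * P.ω k * θ k 2,
    θ k 1 + Complex.I * P.ω k * θ k 3]

/-- `σ` is an eigenvalue of `𝒜`. -/
def IsEigenvalue (σ : ℂ) : Prop :=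
  ∃ θ ∈ P.domA, θ ≠ 0 ∧ ∀ k, P.calA θ k = σ • θ k

/-- The leading term `λ_k⁰`. -/
def lam (k : ℕ) : ℝ :=
  |P.b k| / √(2 + P.b k ^ 2 / (4 * P.ω k ^ 2) +
    2 * ∑' j, if j = k then 0 else
      P.b j ^ 2 * (P.ω k ^ 2 + P.ω j ^ 2) / (P.ω k ^ 2 - P.ω j ^ 2) ^ 2)

/-- The four numbers `σ_k⁺`, `σ_k⁻`, `σ_{-k}⁺`, `σ_{-k}⁻` (in this order) determined by `ν_k`. -/
def sigma (ν : ℕ → ℂ) (k : ℕ) : Fin 4 → ℂ :=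
  ![Complex.I * P.ω k + ν k,
    Complex.I * P.ω k - (starRingEnd ℂ) (ν k),
    -Complex.I * P.ω k + (starRingEnd ℂ) (ν k),
    -Complex.I * P.ω k - ν k]

/-- `ν` labels eigenvalues of `𝒜`: all `σ_k^±`, `σ_{-k}^±` are eigenvalues, no eigenvalue is listed
twice, and `ν_k = λ_k⁰ + ε_k` with `|ε_k| < λ_k⁰ / 2` for all large `k`. -/
structure IsLabelling (ν : ℕ → ℂ) : Prop where
  eigenvalue : ∀ k i, P.IsEigenvalue (P.sigma ν k i)
  injective : Function.Injective fun x : ℕ × Fin 4 => P.sigma ν x.1 x.2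
  asymptotic : ∀ᶠ k in Filter.atTop, ‖ν k - P.lam k‖ < P.lam k / 2

/-! ### The eigenvectors and the Riesz basis -/

/-- The entries of `θ(σ)`. -/
def thetaSeq (σ : ℂ) (j : ℕ) : EuclideanSpace ℂ (Fin 4) :=
  !₂[P.b j / (σ + Complex.I * P.ω j),
    -(P.b j / (σ - Complex.I * P.ω j)),
    P.b j / (σ + Complex.I * P.ω j) ^ 2,
    -(P.b j / (σ - Complex.I * P.ω j) ^ 2)]

theorem tendsto_ω : Filter.Tendsto P.ω Filter.atTop Filter.atTop := by
  obtain ⟨ωs, hpos, hgap⟩ := P.gap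
  have h : ∀ k : ℕ, (k : ℝ) * ωs ≤ P.ω k := by
    intro k
    induction k with
    | zero => simpa using P.ω_pos.le
    | succ k ih =>
      have := hgap k
      push_cast
      linarith
  exact Filter.tendsto_atTop_mono h
    (tendsto_natCast_atTop_atTop.atTop_mul_const hpos)

theorem exists_bound_inv (σ s : ℂ) (hs : ‖s‖ = 1) :
    ∃ C : ℝ, ∀ j, ‖(σ + s * P.ω j)⁻¹‖ ≤ C := by
  have h1 : Filter.Tendsto (fun j => ‖σ + s * P.ω j‖) Filter.atTop Filter.atTop := by
    refine Filter.tendsto_atTop_mono (fun j => ?_)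
      (Filter.tendsto_atTop_add_const_right _ (-‖σ‖) P.tendsto_ω)
    have h2 := norm_sub_norm_le (s * (P.ω j : ℂ)) (-σ)
    rw [sub_neg_eq_add, norm_neg, norm_mul, hs, one_mul, Complex.norm_real, Real.norm_eq_abs,
      add_comm (s * (P.ω j : ℂ))] at h2
    linarith [le_abs_self (P.ω j)]
  have h2 := (h1.inv_tendsto_atTop).bddAbove_range
  obtain ⟨C, hC⟩ := h2
  refine ⟨C, fun j => ?_⟩
  rw [norm_inv]
  exact hC ⟨j, rfl⟩

theorem memlp_thetaSeq (σ : ℂ) : Memℓp (P.thetaSeq σ) 2 := by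
  obtain ⟨C, hC⟩ := P.exists_bound_inv σ Complex.I Complex.norm_I
  obtain ⟨D, hD⟩ := P.exists_bound_inv σ (-Complex.I) (by simp)
  rw [memℓp_gen_iff (by norm_num)]
  simp only [ENNReal.toReal_ofNat, Real.rpow_two]
  refine Summable.of_nonneg_of_le (fun j => by positivity) (fun j => ?_)
    (P.summable_sq.mul_left (C ^ 2 + D ^ 2 + (C ^ 2) ^ 2 + (D ^ 2) ^ 2))
  have hc := hC j
  have hd := hD j
  rw [neg_mul, ← sub_eq_add_neg] at hd
  have hc2 : ‖(σ + Complex.I * P.ω j)⁻¹‖ ^ 2 ≤ C ^ 2 := by gcongr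
  have hd2 : ‖(σ - Complex.I * P.ω j)⁻¹‖ ^ 2 ≤ D ^ 2 := by gcongr
  have hc4 : (‖(σ + Complex.I * P.ω j)⁻¹‖ ^ 2) ^ 2 ≤ (C ^ 2) ^ 2 := by gcongr
  have hd4 : (‖(σ - Complex.I * P.ω j)⁻¹‖ ^ 2) ^ 2 ≤ (D ^ 2) ^ 2 := by gcongr
  have key : ‖P.thetaSeq σ j‖ ^ 2 = (‖(σ + Complex.I * P.ω j)⁻¹‖ ^ 2
      + ‖(σ - Complex.I * P.ω j)⁻¹‖ ^ 2 + (‖(σ + Complex.I * P.ω j)⁻¹‖ ^ 2) ^ 2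
      + (‖(σ - Complex.I * P.ω j)⁻¹‖ ^ 2) ^ 2) * P.b j ^ 2 := by
    rw [EuclideanSpace.norm_sq_eq, Fin.sum_univ_four]
    simp [thetaSeq, div_eq_mul_inv, mul_pow]
    ring
  rw [key]
  gcongr

/-- The vector `θ(σ)` of `X`; it is an eigenvector when `σ` is an eigenvalue. -/
def theta (σ : ℂ) : StateSpace := ⟨P.thetaSeq σ, P.memlp_thetaSeq σ⟩

/-- The vectors `θ_k^z`, `θ_k^ζ`, `θ_k^p`, `θ_k^q` (in this order). -/
def rieszVector (ν : ℕ → ℂ) (k : ℕ) : Fin 4 → StateSpace :=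
  let c : ℂ := 1 / (2 * P.b k * (ν k).re)
  let d : ℂ := 1 / (2 * P.b k)
  let n : ℂ := ν k ^ 2
  let m : ℂ := (starRingEnd ℂ) (ν k) ^ 2
  ![c • (m • P.theta (P.sigma ν k 2) - n • P.theta (P.sigma ν k 3)),
    -(c • (n • P.theta (P.sigma ν k 0) - m • P.theta (P.sigma ν k 1))),
    d • (m • P.theta (P.sigma ν k 2) + n • P.theta (P.sigma ν k 3)),
    -(d • (n • P.theta (P.sigma ν k 0) + m • P.theta (P.sigma ν k 1)))]

/-- `π₀` is the synthesis operator: `π₀ a = ∑_k (a_k^z θ_k^z + a_k^ζ θ_k^ζ + a_k^p θ_k^p + a_k^q θ_k^q)`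
with convergence in `X`. -/
def IsSynthesis (ν : ℕ → ℂ) (π₀ : StateSpace ≃L[ℂ] StateSpace) : Prop :=
  ∀ a : StateSpace, HasSum (fun x : ℕ × Fin 4 => a x.1 x.2 • P.rieszVector ν x.1 x.2) (π₀ a)

end Oscillator

end

/-!
The vectors `θ_k` are quadratically close to the unit vectors, by (A4), so `π₀` is the identity plus
a compact operator, and it is invertible as soon as it is injective. Suppose that a combination of
the `θ_k` vanishes, and write it as a combination of the eigenvectors `θ(s)` with coefficients
`c_s`. The coordinates of this relation say that the meromorphic function `F(z) = ∑ c_s / (z - s)`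
has a double zero at every pole `± i ω_j` of `Q(z) = ∑ b_j² / (z ∓ i ω_j)²`. The eigenvalues solve
`Q(s) = 2`, and multiplying out partial fractions gives `F Q = 2 F`. Since `Q` is not constant,
`F = 0`, so all its residues `c_s` vanish.

In the weighted space, multiplication by `|b_k|^ρ` conjugates `π₀` to an operator on `X` which is
again the identity plus a compact operator, now by (A5). Its range contains the image of `X` under
that multiplication, so it is dense, and this suffices for invertibility.
-/

open Filter Topology

section RieszBasis

variable {𝕜 E F ι : Type*} [RCLike 𝕜]
  [NormedAddCommGroup E] [InnerProductSpace 𝕜 E]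
  [NormedAddCommGroup F] [NormedSpace 𝕜 F] [CompleteSpace F]

theorem isCompactOperator_adjoint [CompleteSpace E] {K : E →L[𝕜] E} (hK : IsCompactOperator K) :
    IsCompactOperator K.adjoint := by
  have key {x y : E} (hx : x ∈ Metric.ball 0 1) (hy : y ∈ Metric.ball 0 1) :
      dist (K.adjoint x) (K.adjoint y) ^ 2 ≤ 2 * dist (K (K.adjoint x)) (K (K.adjoint y)) := by
    rw [dist_eq_norm, dist_eq_norm, ← map_sub, ← map_sub, ← inner_self_eq_norm_sq (𝕜 := 𝕜),
      K.adjoint_inner_left, ← map_sub]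
    refine (RCLike.re_le_norm _).trans ((norm_inner_le_norm _ _).trans ?_)
    gcongr
    linarith [norm_sub_le x y, mem_ball_zero_iff.1 hx, mem_ball_zero_iff.1 hy]
  obtain ⟨V, hV, hVK⟩ := (isCompactOperator_iff_exists_mem_nhds_isCompact_closure_image _).1
    (hK.comp_clm K.adjoint)
  have hKK : TotallyBounded ((fun x => K (K.adjoint x)) '' (V ∩ Metric.ball 0 1)) :=
    hVK.totallyBounded.subset ((Set.image_mono Set.inter_subset_left).trans subset_closure)
  refine (isCompactOperator_iff_exists_mem_nhds_isCompact_closure_image _).2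
    ⟨V ∩ Metric.ball 0 1, inter_mem hV (Metric.ball_mem_nhds 0 one_pos),
      (TotallyBounded.closure (Metric.totallyBounded_iff.2 fun ε hε => ?_)).isCompact_of_isClosed
        isClosed_closure⟩
  obtain ⟨t, ht, htfin, hcover⟩ := Set.exists_subset_image_finite_and.1
    (Metric.finite_approx_of_totallyBounded hKK (ε ^ 2 / 2) (by positivity))
  refine ⟨K.adjoint '' t, htfin.image _, ?_⟩
  rintro _ ⟨x, hx, rfl⟩
  obtain ⟨_, ⟨y, hy, rfl⟩, hxy⟩ := Set.mem_iUnion₂.1 (hcover ⟨x, hx, rfl⟩)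
  refine Set.mem_iUnion₂.2 ⟨_, ⟨y, hy, rfl⟩, lt_of_pow_lt_pow_left₀ 2 hε.le ?_⟩
  linarith [key hx.2 (ht hy).2, Metric.mem_ball.1 hxy]

theorem isUnit_one_add_of_injective {K : F →L[𝕜] F} (hK : IsCompactOperator K)
    (h : Function.Injective (1 + K : F →L[𝕜] F)) : IsUnit (1 + K) := by
  have hres : (-1 : 𝕜) ∈ resolventSet 𝕜 K := by
    refine (hK.hasEigenvalue_or_mem_resolventSet (neg_ne_zero.2 one_ne_zero)).resolve_left
      fun hev => ?_
    obtain ⟨x, hx⟩ := hev.exists_hasEigenvector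
    refine hx.2 (h ?_)
    simpa [add_eq_zero_iff_eq_neg'] using hx.apply_eq_smul
  rw [spectrum.mem_resolventSet_iff, map_neg, map_one, ← neg_add', IsUnit.neg_iff] at hres
  exact hres

theorem isUnit_one_add_of_denseRange [CompleteSpace E] {K : E →L[𝕜] E} (hK : IsCompactOperator K)
    (h : DenseRange (1 + K : E →L[𝕜] E)) : IsUnit (1 + K) := by
  have hadj : 1 + K.adjoint = star (1 + K) := by
    rw [star_add, star_one, ContinuousLinearMap.star_eq_adjoint]
  rw [← isUnit_star, ← hadj]
  refine isUnit_one_add_of_injective (isCompactOperator_adjoint hK) ?_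
  rw [hadj, ContinuousLinearMap.star_eq_adjoint, injective_iff_map_eq_zero]
  intro x hx
  exact h.eq_zero_of_inner_left 𝕜 fun y => by
    rw [← ContinuousLinearMap.adjoint_inner_left, hx, inner_zero_left]

theorem summable_smulRight (b : HilbertBasis ι 𝕜 E) {r : ι → F}
    (hr : Summable fun i => ‖r i‖ ^ 2) :
    Summable fun i => (innerSL 𝕜 (b i)).smulRight (r i) := by
  rw [summable_iff_vanishing_norm] at hr ⊢
  intro ε hε
  obtain ⟨s, hs⟩ := hr (ε ^ 2) (by positivity)
  refine ⟨s, fun t ht => ?_⟩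
  have hst := hs t ht
  have : ‖∑ i ∈ t, (innerSL 𝕜 (b i)).smulRight (r i)‖ ≤ √(∑ i ∈ t, ‖r i‖ ^ 2) := by
    refine ContinuousLinearMap.opNorm_le_bound _ (Real.sqrt_nonneg _) fun a => ?_
    calc ‖(∑ i ∈ t, (innerSL 𝕜 (b i)).smulRight (r i)) a‖
        ≤ ∑ i ∈ t, ‖inner 𝕜 (b i) a‖ * ‖r i‖ := by
          simpa [norm_smul] using norm_sum_le t fun i => inner 𝕜 (b i) a • r i
      _ ≤ √(∑ i ∈ t, ‖inner 𝕜 (b i) a‖ ^ 2) * √(∑ i ∈ t, ‖r i‖ ^ 2) :=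
          Real.sum_mul_le_sqrt_mul_sqrt _ _ _
      _ ≤ √(∑ i ∈ t, ‖r i‖ ^ 2) * ‖a‖ := by
          rw [mul_comm]
          gcongr
          exact Real.sqrt_le_iff.2 ⟨norm_nonneg a, b.orthonormal.sum_inner_products_le a⟩
  refine this.trans_lt ?_
  rw [Real.norm_of_nonneg (by positivity)] at hst
  exact (Real.sqrt_lt' hε).2 hst

theorem exists_isCompactOperator_hasSum (b : HilbertBasis ι 𝕜 E) {r : ι → F}
    (hr : Summable fun i => ‖r i‖ ^ 2) :
    ∃ K : E →L[𝕜] F, IsCompactOperator K ∧ ∀ a, HasSum (fun i => b.repr a i • r i) (K a) := by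
  have hK := (summable_smulRight b hr).hasSum
  refine ⟨_, isClosed_setOfPred_isCompactOperator.mem_of_tendsto hK (.of_forall fun s => ?_),
    fun a => ?_⟩
  · refine (compactOperator (RingHom.id 𝕜) E F).sum_mem fun i _ => ?_
    exact (isCompactOperator_of_locallyCompactSpace_rng
      (ContinuousLinearMap.toSpanSingleton 𝕜 (r i))).comp_clm (innerSL 𝕜 (b i))
  · simpa [b.repr_apply_apply] using hK.mapL (ContinuousLinearMap.apply 𝕜 F a)

theorem exists_synthesis_of_summable_norm_sub_sq [CompleteSpace E] (b : HilbertBasis ι 𝕜 E)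
    {f : ι → E} (hf : Summable fun i => ‖f i - b i‖ ^ 2) :
    ∃ T : E →L[𝕜] E, (∀ a, HasSum (fun i => b.repr a i • f i) (T a)) ∧
      (Function.Injective T ∨ DenseRange T → IsUnit T) := by
  obtain ⟨K, hK, hsum⟩ := exists_isCompactOperator_hasSum b hf
  refine ⟨1 + K, fun a => ?_,
    Or.rec (isUnit_one_add_of_injective hK) (isUnit_one_add_of_denseRange hK)⟩
  simpa [smul_sub] using (b.hasSum_repr a).add (hsum a)

end RieszBasis

section SimpleFractions

variable {𝕜 ι : Type*} [NormedField 𝕜] {s c : ι → 𝕜}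

theorem exists_eventually_one_add_norm_le (hs : Tendsto (fun n => ‖s n‖) cofinite atTop) (z : 𝕜) :
    ∃ C > 0, ∀ᶠ w in 𝓝 z, ∀ n, s n ≠ z → 1 + ‖s n‖ ≤ C * ‖w - s n‖ := by
  obtain ⟨C, hC⟩ : BddAbove (Set.range fun n => (1 + ‖s n‖) / ‖z - s n‖) := by
    refine IsBoundedUnder.bddAbove_range_of_cofinite ⟨4, eventually_map.2 ?_⟩
    filter_upwards [hs.eventually_ge_atTop (2 * ‖z‖ + 1)] with n hn
    have hdist := norm_sub_norm_le (s n) z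
    rw [norm_sub_rev] at hdist
    rw [div_le_iff₀ (by linarith [norm_nonneg z])]
    linarith [norm_nonneg z]
  refine ⟨2 * max C 1, by positivity, ?_⟩
  filter_upwards [Metric.ball_mem_nhds z (ε := 1 / (2 * max C 1)) (by positivity)] with w hw n hn
  rw [mem_ball_iff_norm', lt_div_iff₀ (by positivity)] at hw
  have hpos : 0 < ‖z - s n‖ := norm_sub_pos_iff.2 hn.symm
  calc 1 + ‖s n‖ ≤ 2 * (max C 1 * ‖z - s n‖) - 1 := by
        have := (div_le_iff₀ hpos).1 ((hC ⟨n, rfl⟩).trans (le_max_left C 1))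
        linarith [norm_nonneg (s n)]
    _ ≤ 2 * (max C 1 * (‖z - w‖ + ‖w - s n‖)) - ‖z - w‖ * (2 * max C 1) := by
        gcongr
        exact norm_sub_le_norm_sub_add_norm_sub z w (s n)
    _ = 2 * max C 1 * ‖w - s n‖ := by ring

theorem eventually_forall_ne (hs : Tendsto (fun n => ‖s n‖) cofinite atTop) (z : 𝕜) :
    ∀ᶠ w in 𝓝[≠] z, ∀ n, s n ≠ w := by
  obtain ⟨C, -, hbound⟩ := exists_eventually_one_add_norm_le hs z
  filter_upwards [hbound.filter_mono nhdsWithin_le_nhds, self_mem_nhdsWithin] with w hw hwz n hn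
  have := hw n (hn.trans_ne hwz)
  rw [hn, sub_self, norm_zero, mul_zero] at this
  linarith [norm_nonneg w]

theorem summable_norm_div_sub_pow (hs : Tendsto (fun n => ‖s n‖) cofinite atTop)
    (hc : Summable fun n => ‖c n‖ / (1 + ‖s n‖)) {z : 𝕜} (hz : ∀ n, s n ≠ z) (m : ℕ) :
    Summable fun n => ‖c n / (z - s n) ^ (m + 1)‖ := by
  obtain ⟨C, hC, hbound⟩ := exists_eventually_one_add_norm_le hs z
  refine (hc.mul_left (C ^ (m + 1))).of_nonneg_of_le (fun n => norm_nonneg _) fun n => ?_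
  have hpos : 0 < ‖z - s n‖ := norm_sub_pos_iff.2 (hz n).symm
  have hle : 1 + ‖s n‖ ≤ (C * ‖z - s n‖) ^ (m + 1) :=
    (le_self_pow₀ (by linarith [norm_nonneg (s n)]) m.succ_ne_zero).trans
      (pow_le_pow_left₀ (by positivity) (hbound.self_of_nhds n (hz n)) _)
  rw [norm_div, norm_pow, div_le_iff₀ (by positivity), mul_div_assoc', div_mul_eq_mul_div,
    le_div_iff₀ (by positivity)]
  calc ‖c n‖ * (1 + ‖s n‖) ≤ ‖c n‖ * (C * ‖z - s n‖) ^ (m + 1) := by gcongr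
    _ = C ^ (m + 1) * ‖c n‖ * ‖z - s n‖ ^ (m + 1) := by ring

theorem tendsto_sub_mul_tsum_div_sub [CompleteSpace 𝕜] (hinj : Function.Injective s)
    (hs : Tendsto (fun n => ‖s n‖) cofinite atTop)
    (hc : Summable fun n => ‖c n‖ / (1 + ‖s n‖)) (m : ι) :
    Tendsto (fun z => (z - s m) * ∑' n, c n / (z - s n)) (𝓝[≠] s m) (𝓝 (c m)) := by
  classical
  obtain ⟨C, hC, hbound⟩ := exists_eventually_one_add_norm_le hs (s m)
  have hlim : Tendsto (fun z => ‖z - s m‖ * ∑' n, C * (‖c n‖ / (1 + ‖s n‖))) (𝓝[≠] s m) (𝓝 0) :=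
    Tendsto.mono_left (Continuous.tendsto' (by fun_prop) _ _ (by simp)) nhdsWithin_le_nhds
  rw [tendsto_iff_norm_sub_tendsto_zero]
  refine squeeze_zero' (.of_forall fun _ => norm_nonneg _) ?_ hlim
  filter_upwards [hbound.filter_mono nhdsWithin_le_nhds, eventually_forall_ne hs (s m),
    self_mem_nhdsWithin] with z hz hne hzm
  have hsum : Summable fun n => c n / (z - s n) := by
    simpa using (summable_norm_div_sub_pow hs hc hne 0).of_norm
  rw [hsum.tsum_eq_add_tsum_ite m, mul_add, mul_div_cancel₀ _ (sub_ne_zero.2 hzm),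
    add_sub_cancel_left, norm_mul]
  gcongr
  refine tsum_of_norm_bounded (hc.mul_left C).hasSum fun n => ?_
  split_ifs with hn
  · rw [norm_zero]
    positivity
  · have hpos : 0 < ‖z - s n‖ := norm_sub_pos_iff.2 (hne n).symm
    rw [norm_div, div_le_iff₀ hpos, mul_div_assoc', div_mul_eq_mul_div,
      le_div_iff₀ (by positivity), mul_right_comm, mul_comm]
    gcongr
    exact hz n (hinj.ne hn)

end SimpleFractions

section DoublePoles

variable {κ : Type*} {β τ : κ → ℂ} {g : ℝ} {z : ℂ}

/-- The series of double poles at the points `τ x` with coefficients `β x`. For the poles `± i ω_j`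
with coefficients `b_j²` its value at the eigenvalues of `𝒜` is `2`. -/
noncomputable def doublePoleSum (β τ : κ → ℂ) (z : ℂ) : ℂ := ∑' x, β x / (z - τ x) ^ 2

theorem exists_forall_ne_half_le_norm_sub [Nonempty κ]
    (hτ : Pairwise fun x y => g ≤ ‖τ x - τ y‖) (z : ℂ) :
    ∃ x₀, ∀ x, x ≠ x₀ → g / 2 ≤ ‖z - τ x‖ := by
  by_cases hclose : ∃ x₀, ‖z - τ x₀‖ < g / 2
  · obtain ⟨x₀, hx₀⟩ := hclose
    refine ⟨x₀, fun x hx => ?_⟩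
    have htri := norm_sub_le_norm_sub_add_norm_sub (τ x) z (τ x₀)
    rw [norm_sub_rev (τ x) z] at htri
    linarith [hτ hx]
  · push Not at hclose
    exact ⟨Classical.arbitrary κ, fun x _ => hclose x⟩

theorem exists_pos_eventually_le_norm_sub (hg : 0 < g)
    (hτ : Pairwise fun x y => g ≤ ‖τ x - τ y‖) (hz : ∀ x, z ≠ τ x) :
    ∃ δ > 0, ∀ᶠ w in 𝓝 z, ∀ x, δ ≤ ‖w - τ x‖ := by
  rcases isEmpty_or_nonempty κ with _ | _
  · exact ⟨1, one_pos, .of_forall fun _ x => isEmptyElim x⟩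
  obtain ⟨x₀, hx₀⟩ := exists_forall_ne_half_le_norm_sub hτ z
  obtain ⟨δ, hδ, hmin⟩ : ∃ δ > 0, ∀ x, 2 * δ ≤ ‖z - τ x‖ := by
    have hpos : 0 < ‖z - τ x₀‖ := norm_sub_pos_iff.2 (hz x₀)
    refine ⟨min (g / 2) ‖z - τ x₀‖ / 2, by positivity, fun x => ?_⟩
    rw [mul_div_cancel₀ _ two_ne_zero]
    rcases eq_or_ne x x₀ with rfl | hx
    · exact min_le_right _ _
    · exact (min_le_left _ _).trans (hx₀ x hx)
  refine ⟨δ, hδ, ?_⟩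
  filter_upwards [Metric.ball_mem_nhds z hδ] with w hw x
  linarith [hmin x, mem_ball_iff_norm'.1 hw, norm_sub_le_norm_sub_add_norm_sub z w (τ x)]

theorem norm_div_sub_sq_le {δ : ℝ} (hδ : 0 < δ) {x : κ} (h : δ ≤ ‖z - τ x‖) :
    ‖β x / (z - τ x) ^ 2‖ ≤ ‖β x‖ * (1 / δ ^ 2) := by
  rw [norm_div, norm_pow, div_eq_mul_one_div]
  gcongr

theorem summable_norm_div_sub_sq (hg : 0 < g) (hτ : Pairwise fun x y => g ≤ ‖τ x - τ y‖)
    (hβ : Summable fun x => ‖β x‖) (hz : ∀ x, z ≠ τ x) :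
    Summable fun x => ‖β x / (z - τ x) ^ 2‖ := by
  obtain ⟨δ, hδ, hdist⟩ := exists_pos_eventually_le_norm_sub hg hτ hz
  exact (hβ.mul_right _).of_nonneg_of_le (fun _ => norm_nonneg _)
    fun x => norm_div_sub_sq_le hδ (hdist.self_of_nhds x)

/-- All terms but one are bounded by `4 ‖β x‖ / g²`, and the exceptional term is the sum minus the
other terms. -/
theorem tsum_norm_div_sub_sq_le (hg : 0 < g) (hτ : Pairwise fun x y => g ≤ ‖τ x - τ y‖)
    (hβ : Summable fun x => ‖β x‖) (hz : ∀ x, z ≠ τ x) :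
    ∑' x, ‖β x / (z - τ x) ^ 2‖
      ≤ ‖doublePoleSum β τ z‖ + 2 * ((∑' x, ‖β x‖) * (1 / (g / 2) ^ 2)) := by
  classical
  rcases isEmpty_or_nonempty κ with _ | _
  · simp
  obtain ⟨x₀, hx₀⟩ := exists_forall_ne_half_le_norm_sub hτ z
  have hs := summable_norm_div_sub_sq hg hτ hβ hz
  have hrest : ∑' x, ‖if x = x₀ then 0 else β x / (z - τ x) ^ 2‖
      ≤ (∑' x, ‖β x‖) * (1 / (g / 2) ^ 2) := by
    rw [← tsum_mul_right]
    refine (hs.of_nonneg_of_le (fun _ => norm_nonneg _) fun x => ?_).tsum_le_tsum (fun x => ?_)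
      (hβ.mul_right _)
    · split_ifs <;> simp [div_nonneg]
    · split_ifs with hx
      · rw [norm_zero]
        positivity
      · exact norm_div_sub_sq_le (half_pos hg) (hx₀ x hx)
  have hterm : ‖β x₀ / (z - τ x₀) ^ 2‖ ≤ ‖doublePoleSum β τ z‖
      + ∑' x, ‖if x = x₀ then 0 else β x / (z - τ x) ^ 2‖ := by
    rw [doublePoleSum, eq_sub_of_add_eq (hs.of_norm.tsum_eq_add_tsum_ite x₀).symm]
    refine (norm_sub_le _ _).trans (add_le_add_right (norm_tsum_le_tsum_norm ?_) _)
    refine hs.of_nonneg_of_le (fun _ => norm_nonneg _) fun x => ?_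
    split_ifs <;> simp [div_nonneg]
  rw [hs.tsum_eq_add_tsum_ite x₀]
  have hif : ∀ x, (if x = x₀ then 0 else ‖β x / (z - τ x) ^ 2‖)
      = ‖if x = x₀ then 0 else β x / (z - τ x) ^ 2‖ := fun x => by split_ifs <;> simp
  simp only [hif]
  linarith

theorem analyticAt_doublePoleSum (hg : 0 < g) (hτ : Pairwise fun x y => g ≤ ‖τ x - τ y‖)
    (hβ : Summable fun x => ‖β x‖) (hz : ∀ x, z ≠ τ x) :
    AnalyticAt ℂ (doublePoleSum β τ) z := by
  obtain ⟨δ, hδ, hdist⟩ := exists_pos_eventually_le_norm_sub hg hτ hz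
  obtain ⟨r, hr, hball⟩ := Metric.eventually_nhds_iff_ball.1 hdist
  have hdiff : DifferentiableOn ℂ (doublePoleSum β τ) (Metric.ball z r) := by
    refine Complex.differentiableOn_tsum_of_summable_norm (hβ.mul_right (1 / δ ^ 2))
      (fun x w hw => ?_) Metric.isOpen_ball fun x w hw => norm_div_sub_sq_le hδ (hball w hw x)
    have hne : (w - τ x) ^ 2 ≠ 0 := pow_ne_zero 2 (norm_pos_iff.1 (hδ.trans_le (hball w hw x)))
    exact DifferentiableAt.differentiableWithinAt (by fun_prop (disch := assumption))
  exact hdiff.analyticAt (Metric.ball_mem_nhds z hr)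

theorem tendsto_doublePoleSum_ofReal_atTop (hre : ∀ x, (τ x).re ≤ 0)
    (hβ : Summable fun x => ‖β x‖) :
    Tendsto (fun t : ℝ => doublePoleSum β τ t) atTop (𝓝 0) := by
  have hlim : Tendsto (fun t : ℝ => (∑' x, ‖β x‖) * (1 / t ^ 2)) atTop (𝓝 0) := by
    simpa using (tendsto_pow_atTop two_ne_zero).inv_tendsto_atTop.const_mul (∑' x, ‖β x‖)
  refine squeeze_zero_norm' ?_ hlim
  filter_upwards [eventually_gt_atTop 0] with t ht
  refine tsum_of_norm_bounded (hβ.hasSum.mul_right _) fun x => norm_div_sub_sq_le ht ?_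
  have := Complex.re_le_norm (t - τ x)
  rw [Complex.sub_re, Complex.ofReal_re] at this
  linarith [hre x]

theorem eventually_doublePoleSum_ne [Countable κ] (hg : 0 < g)
    (hτ : Pairwise fun x y => g ≤ ‖τ x - τ y‖) (hre : ∀ x, (τ x).re ≤ 0)
    (hβ : Summable fun x => ‖β x‖) {a : ℂ} (ha : a ≠ 0) (hz : ∀ x, z ≠ τ x) :
    ∀ᶠ w in 𝓝[≠] z, doublePoleSum β τ w ≠ a := by
  refine ((analyticAt_doublePoleSum hg hτ hβ hz).eventually_eq_or_eventually_ne
    analyticAt_const).resolve_left fun hconst => ha ?_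
  have hmem {w : ℂ} : w ∈ (Set.range τ)ᶜ ↔ ∀ x, w ≠ τ x := by
    simp only [Set.mem_compl_iff, Set.mem_range, not_exists, ne_comm]
  have hconn : IsPreconnected (Set.range τ)ᶜ :=
    ((Set.countable_range τ).isPathConnected_compl_of_one_lt_rank
      (by rw [Complex.rank_real_complex]; norm_num)).isConnected.isPreconnected
  have heq : Set.EqOn (doublePoleSum β τ) (fun _ => a) (Set.range τ)ᶜ :=
    AnalyticOnNhd.eqOn_of_preconnected_of_eventuallyEq
      (fun w hw => analyticAt_doublePoleSum hg hτ hβ (hmem.1 hw)) (fun _ _ => analyticAt_const)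
      hconn (hmem.2 hz) hconst
  refine tendsto_nhds_unique (tendsto_const_nhds.congr' ?_)
    (tendsto_doublePoleSum_ofReal_atTop hre hβ)
  filter_upwards [eventually_gt_atTop 0] with t ht
  refine (heq (hmem.2 fun x h => ?_)).symm
  have := congrArg Complex.re h
  rw [Complex.ofReal_re] at this
  linarith [hre x]

variable {ι : Type*} {s c : ι → ℂ} {a : ℂ}

theorem hasSum_div_sub_mul_one_div_sq {F t : ℂ} (hzt : z ≠ t) (hst : ∀ n, s n ≠ t)
    (hsz : ∀ n, s n ≠ z) (hF : HasSum (fun n => c n / (z - s n)) F)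
    (h₁ : HasSum (fun n => c n / (s n - t)) 0) (h₂ : HasSum (fun n => c n / (s n - t) ^ 2) 0) :
    HasSum (fun n => c n / (z - s n) * (1 / (s n - t) ^ 2)) (F * (1 / (z - t) ^ 2)) := by
  have h := ((hF.add h₁).mul_left (1 / (z - t) ^ 2)).add (h₂.mul_left (1 / (z - t)))
  rw [add_zero, mul_zero, add_zero, mul_comm _ F] at h
  convert! h using 2 with n
  have hz := sub_ne_zero.2 hzt
  have hs := sub_ne_zero.2 (hst n)
  have hzs := sub_ne_zero.2 (hsz n).symm
  field_simp
  ring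

theorem tsum_div_sub_mul_doublePoleSum (hg : 0 < g) (hτ : Pairwise fun x y => g ≤ ‖τ x - τ y‖)
    (hβ : Summable fun x => ‖β x‖) (hs : Tendsto (fun n => ‖s n‖) cofinite atTop)
    (hc : Summable fun n => ‖c n‖ / (1 + ‖s n‖)) (hsτ : ∀ n x, s n ≠ τ x)
    (ha : ∀ n, doublePoleSum β τ (s n) = a)
    (h₁ : ∀ x, HasSum (fun n => c n / (s n - τ x)) 0)
    (h₂ : ∀ x, HasSum (fun n => c n / (s n - τ x) ^ 2) 0)
    (hz : ∀ x, z ≠ τ x) (hsz : ∀ n, s n ≠ z) :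
    (∑' n, c n / (z - s n)) * doublePoleSum β τ z = (∑' n, c n / (z - s n)) * a := by
  have hF : Summable fun n => ‖c n / (z - s n)‖ := by
    simpa using summable_norm_div_sub_pow hs hc hsz 0
  have hcol (x : κ) : HasSum (fun n => c n / (z - s n) * (β x / (s n - τ x) ^ 2))
      ((∑' n, c n / (z - s n)) * (β x / (z - τ x) ^ 2)) := by
    have h := (hasSum_div_sub_mul_one_div_sq (hz x) (fun n => hsτ n x) hsz hF.of_norm.hasSum
      (h₁ x) (h₂ x)).mul_left (β x)
    simp only [mul_left_comm (β x)] at h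
    simpa only [mul_one_div] using h
  have hdouble : Summable (Function.uncurry fun n x =>
      c n / (z - s n) * (β x / (s n - τ x) ^ 2)) := by
    refine .of_norm ((summable_prod_of_nonneg fun _ => norm_nonneg _).2 ⟨fun n => ?_, ?_⟩)
    · simp only [Function.uncurry_apply_pair, norm_mul]
      exact (summable_norm_div_sub_sq hg hτ hβ (hsτ n)).mul_left _
    · simp only [Function.uncurry_apply_pair, norm_mul, tsum_mul_left]
      refine (hF.mul_right (‖a‖ + 2 * ((∑' x, ‖β x‖) * (1 / (g / 2) ^ 2)))).of_nonneg_of_le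
        (fun n => by positivity) fun n => ?_
      gcongr
      exact (tsum_norm_div_sub_sq_le hg hτ hβ (hsτ n)).trans_eq (by rw [ha n])
  have hcomm := hdouble.tsum_comm
  simp only [fun x => (hcol x).tsum_eq, tsum_mul_left] at hcomm
  rw [doublePoleSum, hcomm, ← tsum_mul_right]
  exact tsum_congr fun n => congrArg _ (ha n)

theorem eq_zero_of_hasSum_div_sub_pow_eq_zero [Countable κ] (hg : 0 < g)
    (hτ : Pairwise fun x y => g ≤ ‖τ x - τ y‖) (hre : ∀ x, (τ x).re ≤ 0)
    (hβ : Summable fun x => ‖β x‖) (hinj : Function.Injective s)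
    (hs : Tendsto (fun n => ‖s n‖) cofinite atTop)
    (hc : Summable fun n => ‖c n‖ / (1 + ‖s n‖)) (hsτ : ∀ n x, s n ≠ τ x) (ha₀ : a ≠ 0)
    (ha : ∀ n, doublePoleSum β τ (s n) = a)
    (h₁ : ∀ x, HasSum (fun n => c n / (s n - τ x)) 0)
    (h₂ : ∀ x, HasSum (fun n => c n / (s n - τ x) ^ 2) 0) : c = 0 := by
  funext m
  obtain ⟨δ, hδ, hdist⟩ := exists_pos_eventually_le_norm_sub hg hτ (hsτ m)
  refine tendsto_nhds_unique (tendsto_sub_mul_tsum_div_sub hinj hs hc m)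
    (tendsto_const_nhds.congr' ?_)
  filter_upwards [hdist.filter_mono nhdsWithin_le_nhds, eventually_forall_ne hs (s m),
    eventually_doublePoleSum_ne hg hτ hre hβ ha₀ (hsτ m)] with z hz hsz hne
  have hzτ (x : κ) : z ≠ τ x := norm_sub_pos_iff.1 (hδ.trans_le (hz x))
  have hF : ∑' n, c n / (z - s n) = 0 := by
    by_contra hF
    exact hne (mul_left_cancel₀ hF
      (tsum_div_sub_mul_doublePoleSum hg hτ hβ hs hc hsτ ha h₁ h₂ hzτ hsz))
  rw [hF, mul_zero, Pi.zero_apply]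

end DoublePoles

theorem eventually_cofinite_fst {β : Type*} [Finite β] {p : ℕ → Prop} (h : ∀ᶠ k in atTop, p k) :
    ∀ᶠ x : ℕ × β in cofinite, p x.1 := by
  rw [← Nat.cofinite_eq_atTop, eventually_cofinite] at h
  rw [eventually_cofinite]
  exact (h.prod Set.finite_univ).subset fun x hx => ⟨hx, Set.mem_univ _⟩

theorem summable_prod_of_eventually_norm_le {β E : Type*} [Finite β] [NormedAddCommGroup E]
    [CompleteSpace E] {f : ℕ × β → E} {u : ℕ → ℝ} (hu : Summable u)
    (h : ∀ᶠ k in atTop, ∀ i, ‖f (k, i)‖ ≤ u k) : Summable f := by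
  have hβ : Summable fun _ : β => (1 : ℝ) := summable_of_hasFiniteSupport (Set.toFinite _)
  refine .of_norm_bounded_eventually
    (hu.abs.mul_of_nonneg hβ (fun _ => abs_nonneg _) fun _ => zero_le_one) ?_
  filter_upwards [eventually_cofinite_fst h] with x hx
  exact (hx x.2).trans ((le_abs_self _).trans_eq (mul_one _).symm)

namespace StateSpace

/-- The unit vectors of the state space. -/
noncomputable def unit (x : ℕ × Fin 4) : StateSpace :=
  lp.single 2 x.1 (EuclideanSpace.single x.2 1)

theorem unit_apply (k j : ℕ) (i l : Fin 4) :
    unit (k, i) j l = if (j, l) = (k, i) then 1 else 0 := by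
  rcases eq_or_ne j k with rfl | hj
  · simp [unit]
  · simp [unit, hj]

theorem inner_unit (x : ℕ × Fin 4) (a : StateSpace) : inner ℂ (unit x) a = a x.1 x.2 := by
  rw [unit, lp.inner_single_left, EuclideanSpace.inner_single_left, map_one, one_mul]

theorem orthonormal_unit : Orthonormal ℂ unit := by
  classical
  refine orthonormal_iff_ite.2 fun x y => ?_
  rw [inner_unit, ← Prod.mk.eta (p := y), unit_apply]

theorem orthogonal_span_unit : (Submodule.span ℂ (Set.range unit))ᗮ = ⊥ := by
  refine (Submodule.eq_bot_iff _).2 fun a ha => ?_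
  ext k i
  exact (inner_unit (k, i) a).symm.trans
    ((Submodule.mem_orthogonal _ _).1 ha _ (Submodule.subset_span ⟨(k, i), rfl⟩))

/-- The Hilbert basis of unit vectors. -/
noncomputable def basis : HilbertBasis (ℕ × Fin 4) ℂ StateSpace :=
  .mkOfOrthogonalEqBot orthonormal_unit orthogonal_span_unit

theorem basis_apply (x : ℕ × Fin 4) : basis x = unit x :=
  congrFun (HilbertBasis.coe_mkOfOrthogonalEqBot _ _) x

theorem basis_repr_apply (a : StateSpace) (x : ℕ × Fin 4) : basis.repr a x = a x.1 x.2 := by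
  rw [HilbertBasis.repr_apply_apply, basis_apply, inner_unit]

theorem hasSum_norm_sq (a : StateSpace) : HasSum (fun k => ‖a k‖ ^ 2) (‖a‖ ^ 2) := by
  simpa using lp.hasSum_norm (p := 2) (by norm_num) a

end StateSpace

namespace Oscillator

/-- The coordinates `z, ζ, p, q` of `ℂ⁴` as pairs `(h, ε)`: the side `ε` separates `z, p` from
`ζ, q`, and `h` is one less than the order of the pole of the coordinate in `thetaSeq`. The four
eigenvalues of `sigma` near `∓ i ω_k` are numbered by the same bijection. -/
def pairEquiv : Fin 2 × Fin 2 ≃ Fin 4 := finProdFinEquiv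

/-- The signs attached to the two sides. -/
def sgn : Fin 2 → ℝ := ![1, -1]

theorem sgn_eq_one_or_neg_one (ε : Fin 2) : sgn ε = 1 ∨ sgn ε = -1 := by
  fin_cases ε <;> simp [sgn]

theorem abs_sgn (ε : Fin 2) : |sgn ε| = 1 := by
  rcases sgn_eq_one_or_neg_one ε with h | h <;> simp [h]

theorem sgn_mul_self (ε : Fin 2) : (sgn ε * sgn ε : ℂ) = 1 := by
  rcases sgn_eq_one_or_neg_one ε with h | h <;> simp [h]

theorem sgn_ne_zero (ε : Fin 2) : sgn ε ≠ 0 := by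
  rcases sgn_eq_one_or_neg_one ε with h | h <;> simp [h]

variable (P : Oscillator)

/-- The points `-i ω_k` (side `0`) and `i ω_k` (side `1`), at which the coordinates of `thetaSeq`
have their poles. -/
def pole (x : ℕ × Fin 2) : ℂ := ((-(sgn x.2 * P.ω x.1) : ℝ) : ℂ) * Complex.I

theorem ofReal_b_ne_zero (k : ℕ) : (P.b k : ℂ) ≠ 0 := Complex.ofReal_ne_zero.2 (P.b_ne_zero k)

theorem abs_b_pos (k : ℕ) : 0 < |P.b k| := abs_pos.2 (P.b_ne_zero k)

theorem exists_forall_mul_abs_sub_le_abs_ω_sub :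
    ∃ g > 0, ∀ j k : ℕ, g * |(j : ℝ) - k| ≤ |P.ω j - P.ω k| := by
  obtain ⟨g, hg, hgap⟩ := P.gap
  have hmono : Monotone fun k : ℕ => P.ω k - g * k := monotone_nat_of_le_succ fun k => by
    push_cast
    linarith [hgap k]
  refine ⟨g, hg, fun j k => ?_⟩
  wlog hjk : j ≤ k generalizing j k
  · rw [abs_sub_comm, abs_sub_comm (P.ω j)]
    exact this k j (le_of_not_ge hjk)
  have hcast : (j : ℝ) ≤ k := by exact_mod_cast hjk
  rw [abs_sub_comm, abs_of_nonneg (sub_nonneg.2 hcast), abs_sub_comm]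
  exact le_abs.2 (.inl (by linarith [hmono hjk]))

theorem ω_zero_le (k : ℕ) : P.ω 0 ≤ P.ω k := by
  obtain ⟨g, hg, hgap⟩ := P.gap
  exact monotone_nat_of_le_succ (fun k => by linarith [hgap k]) k.zero_le

theorem norm_pole_sub (x y : ℕ × Fin 2) :
    ‖P.pole x - P.pole y‖ = |sgn x.2 * P.ω x.1 - sgn y.2 * P.ω y.1| := by
  rw [pole, pole, ← sub_mul, norm_mul, Complex.norm_I, mul_one, ← Complex.ofReal_sub,
    Complex.norm_real, Real.norm_eq_abs, ← abs_neg]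
  ring_nf

theorem norm_pole (x : ℕ × Fin 2) : ‖P.pole x‖ = P.ω x.1 := by
  rw [pole, norm_mul, Complex.norm_I, mul_one, Complex.norm_real, norm_neg, norm_mul,
    Real.norm_eq_abs, abs_sgn, one_mul, Real.norm_of_nonneg (P.ω_pos.le.trans (P.ω_zero_le _))]

theorem pole_re (x : ℕ × Fin 2) : (P.pole x).re = 0 := by simp [pole]

theorem abs_ω_sub_le_norm_pole_sub (x y : ℕ × Fin 2) :
    |P.ω x.1 - P.ω y.1| ≤ ‖P.pole x - P.pole y‖ := by
  simpa only [norm_pole] using abs_norm_sub_norm_le (P.pole x) (P.pole y)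

theorem exists_pairwise_le_norm_pole_sub :
    ∃ g > 0, Pairwise fun x y => g ≤ ‖P.pole x - P.pole y‖ := by
  obtain ⟨g, hg, hgap⟩ := P.exists_forall_mul_abs_sub_le_abs_ω_sub
  refine ⟨min g (P.ω 0), lt_min hg P.ω_pos, ?_⟩
  rintro ⟨j, ε⟩ ⟨k, η⟩ hne
  rcases eq_or_ne j k with rfl | hjk
  · rw [norm_pole_sub, ← sub_mul, abs_mul]
    have hεη : 1 ≤ |sgn ε - sgn η| := by
      fin_cases ε <;> fin_cases η <;> first | exact absurd rfl hne | norm_num [sgn]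
    calc min g (P.ω 0) ≤ 1 * |P.ω j| := by
          rw [one_mul]
          exact (min_le_right _ _).trans ((P.ω_zero_le j).trans (le_abs_self _))
      _ ≤ |sgn ε - sgn η| * |P.ω j| := by gcongr
  · have hone : 1 ≤ |(j : ℝ) - k| := by
      exact_mod_cast Int.one_le_abs (sub_ne_zero.2 (Nat.cast_injective.ne hjk : (j : ℤ) ≠ k))
    calc min g (P.ω 0) ≤ g * 1 := by simp
      _ ≤ g * |(j : ℝ) - k| := by gcongr
      _ ≤ |P.ω j - P.ω k| := hgap j k
      _ ≤ ‖P.pole (j, ε) - P.pole (k, η)‖ := P.abs_ω_sub_le_norm_pole_sub (j, ε) (k, η)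

theorem thetaSeq_pairEquiv (σ : ℂ) (j : ℕ) (h ε : Fin 2) :
    P.thetaSeq σ j (pairEquiv (h, ε))
      = sgn ε * P.b j / (σ - P.pole (j, ε)) ^ ((h : ℕ) + 1) := by
  fin_cases h <;> fin_cases ε <;>
    simp [thetaSeq, pairEquiv, finProdFinEquiv, pole, sgn, mul_comm, neg_div]

theorem calA_pairEquiv_zero (θ : StateSpace) (x : ℕ × Fin 2) :
    P.calA θ x.1 (pairEquiv (0, x.2))
      = P.pole x * θ x.1 (pairEquiv (0, x.2)) + sgn x.2 * P.b x.1 * P.phi θ := by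
  obtain ⟨k, ε⟩ := x
  fin_cases ε <;> simp [calA, pairEquiv, finProdFinEquiv, pole, sgn, mul_comm, sub_eq_add_neg]

theorem calA_pairEquiv_one (θ : StateSpace) (x : ℕ × Fin 2) :
    P.calA θ x.1 (pairEquiv (1, x.2))
      = θ x.1 (pairEquiv (0, x.2)) + P.pole x * θ x.1 (pairEquiv (1, x.2)) := by
  obtain ⟨k, ε⟩ := x
  fin_cases ε <;> simp [calA, pairEquiv, finProdFinEquiv, pole, sgn, mul_comm, sub_eq_add_neg]

theorem summable_b_mul_norm (θ : StateSpace) : Summable fun k => |P.b k| * ‖θ k‖ := by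
  refine (P.summable_sq.add (StateSpace.hasSum_norm_sq θ).summable).of_nonneg_of_le
    (fun k => by positivity) fun k => ?_
  nlinarith [sq_abs (P.b k), two_mul_le_add_sq |P.b k| ‖θ k‖, sq_nonneg |P.b k|, sq_nonneg ‖θ k‖]

theorem hasSum_two_mul_phi (θ : StateSpace) :
    HasSum (fun x : ℕ × Fin 2 => P.b x.1 * (sgn x.2 * θ x.1 (pairEquiv (1, x.2))))
      (2 * P.phi θ) := by
  have hsum : Summable fun x : ℕ × Fin 2 =>
      P.b x.1 * (sgn x.2 * θ x.1 (pairEquiv (1, x.2))) := by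
    refine summable_prod_of_eventually_norm_le (P.summable_b_mul_norm θ) (.of_forall fun k ε => ?_)
    simp only [norm_mul, Complex.norm_real, Real.norm_eq_abs, abs_sgn, one_mul]
    gcongr
    exact PiLp.norm_apply_le (θ k) _
  have hphi : 2 * P.phi θ
      = ∑' x : ℕ × Fin 2, P.b x.1 * (sgn x.2 * θ x.1 (pairEquiv (1, x.2))) := by
    rw [hsum.tsum_prod, phi, ← mul_assoc, mul_one_div_cancel two_ne_zero, one_mul]
    refine tsum_congr fun k => ?_
    have h₀ : (pairEquiv (1, 0) : Fin 4) = 2 := rfl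
    have h₁ : (pairEquiv (1, 1) : Fin 4) = 3 := rfl
    simp only [tsum_fintype, Fin.sum_univ_two, sgn, h₀, h₁, Matrix.cons_val_zero,
      Matrix.cons_val_one, Complex.ofReal_neg, Complex.ofReal_one]
    ring
  exact hphi ▸ hsum.hasSum

theorem summable_norm_b_sq : Summable fun x : ℕ × Fin 2 => ‖(P.b x.1 : ℂ) ^ 2‖ :=
  (summable_prod_of_eventually_norm_le P.summable_sq (.of_forall fun k _ => by simp)).norm

variable {P} {σ : ℂ} {θ : StateSpace}

theorem ext_pairEquiv
    (hθ : ∀ (x : ℕ × Fin 2) (h : Fin 2), θ x.1 (pairEquiv (h, x.2)) = 0) : θ = 0 := by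
  ext k i
  obtain ⟨⟨h, ε⟩, rfl⟩ := pairEquiv.surjective i
  exact hθ (k, ε) h

theorem sub_pole_mul_eq_of_calA_eq (hθ : ∀ k, P.calA θ k = σ • θ k) (x : ℕ × Fin 2) :
    (σ - P.pole x) * θ x.1 (pairEquiv (0, x.2)) = sgn x.2 * P.b x.1 * P.phi θ ∧
      (σ - P.pole x) * θ x.1 (pairEquiv (1, x.2)) = θ x.1 (pairEquiv (0, x.2)) := by
  have h₀ := (P.calA_pairEquiv_zero θ x).symm.trans (by rw [hθ])
  have h₁ := (P.calA_pairEquiv_one θ x).symm.trans (by rw [hθ])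
  rw [PiLp.smul_apply, smul_eq_mul] at h₀ h₁
  constructor
  · linear_combination -h₀
  · linear_combination -h₁

theorem phi_ne_zero (hθ₀ : θ ≠ 0) (hθ : ∀ k, P.calA θ k = σ • θ k) : P.phi θ ≠ 0 := by
  intro hφ
  have hzero {x : ℕ × Fin 2} (hx : σ ≠ P.pole x) (h : Fin 2) :
      θ x.1 (pairEquiv (h, x.2)) = 0 := by
    obtain ⟨hlow, hhigh⟩ := sub_pole_mul_eq_of_calA_eq hθ x
    have hlow₀ : θ x.1 (pairEquiv (0, x.2)) = 0 := by
      simpa [hφ, sub_ne_zero.2 hx] using hlow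
    have hhigh₀ : θ x.1 (pairEquiv (1, x.2)) = 0 := by
      simpa [hlow₀, sub_ne_zero.2 hx] using hhigh
    fin_cases h <;> assumption
  refine hθ₀ (ext_pairEquiv fun x h => ?_)
  by_cases hx : σ = P.pole x
  · have hlow₀ : θ x.1 (pairEquiv (0, x.2)) = 0 := by
      simpa [hx] using (sub_pole_mul_eq_of_calA_eq hθ x).2.symm
    have hothers (y : ℕ × Fin 2) (hy : y ≠ x) :
        P.b y.1 * (sgn y.2 * θ y.1 (pairEquiv (1, y.2))) = 0 := by
      obtain ⟨g, hg, hgap⟩ := P.exists_pairwise_le_norm_pole_sub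
      have hxy : σ ≠ P.pole y := by
        rw [hx]
        exact norm_sub_pos_iff.1 (hg.trans_le (hgap hy.symm))
      rw [hzero hxy, mul_zero, mul_zero]
    have hφx := (P.hasSum_two_mul_phi θ).unique (hasSum_single x hothers)
    have hhigh₀ : θ x.1 (pairEquiv (1, x.2)) = 0 := by
      simpa [hφ, P.b_ne_zero, sgn_ne_zero] using hφx
    fin_cases h <;> assumption
  · exact hzero hx h

theorem IsEigenvalue.ne_pole (hσ : P.IsEigenvalue σ) (x : ℕ × Fin 2) : σ ≠ P.pole x := by
  obtain ⟨θ, -, hθ₀, hθ⟩ := hσ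
  rintro rfl
  have h := (sub_pole_mul_eq_of_calA_eq hθ x).1
  rw [sub_self, zero_mul] at h
  exact mul_ne_zero (mul_ne_zero (Complex.ofReal_ne_zero.2 (sgn_ne_zero _)) (P.ofReal_b_ne_zero _))
    (phi_ne_zero hθ₀ hθ) h.symm

theorem IsEigenvalue.doublePoleSum_eq_two (hσ : P.IsEigenvalue σ) :
    doublePoleSum (fun x => (P.b x.1 : ℂ) ^ 2) P.pole σ = 2 := by
  have hne := hσ.ne_pole
  obtain ⟨θ, -, hθ₀, hθ⟩ := hσ
  refine mul_left_cancel₀ (phi_ne_zero hθ₀ hθ) ?_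
  rw [doublePoleSum, ← tsum_mul_left, mul_comm _ 2, ← (P.hasSum_two_mul_phi θ).tsum_eq]
  refine tsum_congr fun x => ?_
  obtain ⟨hlow, hhigh⟩ := sub_pole_mul_eq_of_calA_eq hθ x
  have hx := sub_ne_zero.2 (hne x)
  rw [← hhigh] at hlow
  rw [mul_div_assoc', div_eq_iff (pow_ne_zero 2 hx)]
  linear_combination -(P.phi θ * P.b x.1 ^ 2) * sgn_mul_self x.2 - P.b x.1 * sgn x.2 * hlow

variable (P)

/-- The displacements of the four eigenvalues of `sigma` from the nearby poles: `shift ν k ε` has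
the two displacements from the pole on side `ε` as entries. -/
def shift (ν : ℕ → ℂ) (k : ℕ) : Matrix (Fin 2) (Fin 2) ℂ :=
  !![(starRingEnd ℂ) (ν k), -ν k; ν k, -(starRingEnd ℂ) (ν k)]

theorem shift_eq (ν : ℕ → ℂ) (k : ℕ) (ε η : Fin 2) :
    shift ν k ε η = sgn η * (ν k).re - sgn ε * (ν k).im * Complex.I := by
  fin_cases ε <;> fin_cases η <;> simp [shift, sgn, Complex.ext_iff]

theorem norm_shift (ν : ℕ → ℂ) (k : ℕ) (ε η : Fin 2) : ‖shift ν k ε η‖ = ‖ν k‖ := by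
  fin_cases ε <;> fin_cases η <;> simp [shift]

/-- The eigenvalues of `sigma`, numbered by `(k, ε, η)` so that `ε` is the side of the nearby
pole. -/
def eig (ν : ℕ → ℂ) (n : ℕ × Fin 2 × Fin 2) : ℂ :=
  P.sigma ν n.1 (pairEquiv (n.2.1.rev, n.2.2))

theorem eig_eq (ν : ℕ → ℂ) (k : ℕ) (ε η : Fin 2) :
    P.eig ν (k, ε, η) = P.pole (k, ε) + shift ν k ε η := by
  fin_cases ε <;> fin_cases η <;>
    simp [eig, sigma, pairEquiv, finProdFinEquiv, pole, shift, sgn, mul_comm, sub_eq_add_neg]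

/-- The coefficients of the Riesz vectors with respect to the eigenvectors of the same side. -/
noncomputable def eigenCoeff (ν : ℕ → ℂ) (k : ℕ) (h ε η : Fin 2) : ℂ :=
  sgn ε * (shift ν k ε η ^ 2 / (2 * P.b k)) * ![(sgn η / (ν k).re : ℂ), 1] h

theorem rieszVector_pairEquiv (ν : ℕ → ℂ) (k : ℕ) (h ε : Fin 2) :
    P.rieszVector ν k (pairEquiv (h, ε))
      = ∑ η, P.eigenCoeff ν k h ε η • P.theta (P.eig ν (k, ε, η)) := by
  fin_cases h <;> fin_cases ε <;>
    simp only [rieszVector, eigenCoeff, shift, sgn, eig, pairEquiv, finProdFinEquiv,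
      Equiv.coe_fn_mk, Fin.sum_univ_two, Fin.zero_eta, Fin.mk_one, Fin.isValue, Fin.reduceRev,
      Fin.coe_ofNat_eq_mod, Nat.reduceMul, Nat.reduceMod, Nat.reduceAdd, Fin.reduceFinMk,
      Matrix.cons_val, Matrix.of_apply, Matrix.cons_val', Complex.ofReal_neg,
      Complex.ofReal_one] <;>
    module

theorem thetaSeq_eig_pairEquiv_self (ν : ℕ → ℂ) (k : ℕ) (h ε η : Fin 2) :
    P.thetaSeq (P.eig ν (k, ε, η)) k (pairEquiv (h, ε))
      = sgn ε * P.b k / shift ν k ε η ^ ((h : ℕ) + 1) := by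
  rw [thetaSeq_pairEquiv, eig_eq, add_sub_cancel_left]

theorem rieszVector_pairEquiv_apply (ν : ℕ → ℂ) (k j : ℕ) (h ε : Fin 2) (i : Fin 4) :
    P.rieszVector ν k (pairEquiv (h, ε)) j i
      = ∑ η, P.eigenCoeff ν k h ε η * P.thetaSeq (P.eig ν (k, ε, η)) j i := by
  rw [rieszVector_pairEquiv, Fin.sum_univ_two, Fin.sum_univ_two]
  rfl

theorem lam_le_abs_b (k : ℕ) : P.lam k ≤ |P.b k| := by
  refine div_le_self (abs_nonneg _) (Real.one_le_sqrt.2 ?_)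
  have hsum : 0 ≤ ∑' j, if j = k then 0 else
      P.b j ^ 2 * (P.ω k ^ 2 + P.ω j ^ 2) / (P.ω k ^ 2 - P.ω j ^ 2) ^ 2 :=
    tsum_nonneg fun j => by split_ifs <;> positivity
  have hsq : 0 ≤ P.b k ^ 2 / (4 * P.ω k ^ 2) := by positivity
  linarith

theorem tendsto_abs_b : Tendsto (fun k => |P.b k|) atTop (𝓝 0) := by
  simpa [Real.sqrt_sq_eq_abs] using P.summable_sq.tendsto_atTop_zero.sqrt

namespace IsLabelling

variable {P} {ν : ℕ → ℂ} (hν : P.IsLabelling ν)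
include hν

theorem eig_injective : Function.Injective (P.eig ν) := by
  rintro ⟨k, ε, η⟩ ⟨k', ε', η'⟩ h
  obtain ⟨rfl, hi⟩ := Prod.mk.inj (hν.injective h)
  obtain ⟨hε, rfl⟩ := Prod.mk.inj (pairEquiv.injective hi)
  obtain rfl := Fin.rev_injective hε
  rfl

theorem isEigenvalue_eig (n : ℕ × Fin 2 × Fin 2) : P.IsEigenvalue (P.eig ν n) :=
  hν.eigenvalue _ _

theorem re_ne_zero (k : ℕ) : (ν k).re ≠ 0 := by
  intro hre
  have h := hν.eig_injective (a₁ := (k, 0, 0)) (a₂ := (k, 0, 1)) (by simp [eig_eq, shift_eq, hre])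
  simp at h

theorem shift_ne_zero (k : ℕ) (ε η : Fin 2) : shift ν k ε η ≠ 0 := by
  rw [← norm_pos_iff, norm_shift, norm_pos_iff]
  exact fun h => hν.re_ne_zero k (by simp [h])

theorem eventually_norm_le_abs_b : ∀ᶠ k in atTop, 0 < (ν k).re ∧ ‖ν k‖ ≤ 2 * |P.b k| ∧
    ‖ν k‖ ^ 2 ≤ 5 * (|P.b k| * (ν k).re) := by
  filter_upwards [hν.asymptotic] with k hk
  have hlam_le := P.lam_le_abs_b k
  have hlam : 0 < P.lam k := by linarith [(norm_nonneg _).trans_lt hk]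
  have hre : P.lam k / 2 ≤ (ν k).re := by
    have := (abs_le.1 ((Complex.abs_re_le_norm _).trans hk.le)).1
    rw [Complex.sub_re, Complex.ofReal_re] at this
    linarith
  have hnorm : ‖ν k‖ ≤ 3 / 2 * P.lam k := by
    have := norm_sub_norm_le (ν k) (P.lam k)
    rw [Complex.norm_of_nonneg hlam.le] at this
    linarith
  refine ⟨by linarith, by linarith, ?_⟩
  calc ‖ν k‖ ^ 2 ≤ (3 / 2 * P.lam k) ^ 2 := by gcongr
    _ = 9 / 2 * (P.lam k * (P.lam k / 2)) := by ring
    _ ≤ 5 * (|P.b k| * (ν k).re) := by gcongr; norm_num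

theorem eventually_norm_le {δ : ℝ} (hδ : 0 < δ) : ∀ᶠ k in atTop, ‖ν k‖ ≤ δ := by
  filter_upwards [hν.eventually_norm_le_abs_b, P.tendsto_abs_b.eventually_le_const (half_pos hδ)]
    with k hk hb
  linarith [hk.2.1]

theorem eventually_norm_eigenCoeff_le :
    ∀ᶠ k in atTop, ∀ h ε η, ‖P.eigenCoeff ν k h ε η‖ ≤ 5 / 2 := by
  filter_upwards [hν.eventually_norm_le_abs_b, hν.eventually_norm_le one_pos]
    with k ⟨hre, hbound⟩ hν₁ h ε η
  have hb := P.abs_b_pos k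
  have hre₁ : (ν k).re ≤ 1 := (Complex.re_le_norm _).trans hν₁
  have hnorm : ‖P.eigenCoeff ν k h ε η‖
      = ‖ν k‖ ^ 2 / (2 * |P.b k|) * ![1 / (ν k).re, 1] h := by
    fin_cases h <;> simp [eigenCoeff, norm_shift, abs_sgn, abs_of_pos hre]
  have hquot : ‖ν k‖ ^ 2 / (2 * |P.b k|) ≤ 5 / 2 * (ν k).re := by
    rw [div_le_iff₀ (by positivity)]
    linarith [hbound.2]
  have hfactor : ![1 / (ν k).re, 1] h ≤ 1 / (ν k).re := by
    fin_cases h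
    · exact le_refl (1 / (ν k).re)
    · exact one_le_one_div hre hre₁
  calc ‖P.eigenCoeff ν k h ε η‖
      ≤ ‖ν k‖ ^ 2 / (2 * |P.b k|) * (1 / (ν k).re) := by rw [hnorm]; gcongr
    _ ≤ 5 / 2 * (ν k).re * (1 / (ν k).re) := by gcongr
    _ = 5 / 2 := by field_simp

theorem rieszVector_pairEquiv_apply_self (k : ℕ) (h' h ε : Fin 2) :
    P.rieszVector ν k (pairEquiv (h', ε)) k (pairEquiv (h, ε))
      = !![1, 0; -(sgn ε * (ν k).im * Complex.I), 1] h' h := by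
  have hre : ((ν k).re : ℂ) ≠ 0 := Complex.ofReal_ne_zero.2 (hν.re_ne_zero k)
  have hb := P.ofReal_b_ne_zero k
  have hterm (η : Fin 2) : P.eigenCoeff ν k h' ε η * P.thetaSeq (P.eig ν (k, ε, η)) k
      (pairEquiv (h, ε)) = ![(sgn η / (ν k).re : ℂ), 1] h' / 2 * ![shift ν k ε η, 1] h := by
    have hη := hν.shift_ne_zero k ε η
    rw [thetaSeq_eig_pairEquiv_self, eigenCoeff]
    fin_cases h <;>
      simp only [Fin.zero_eta, Fin.mk_one, Fin.isValue, Matrix.cons_val_zero, Matrix.cons_val_one,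
        zero_add, Nat.reduceAdd] <;>
      field_simp <;>
      simp only [pow_two, sgn_mul_self, one_mul]
  rw [rieszVector_pairEquiv_apply, Fin.sum_univ_two, hterm, hterm]
  fin_cases h' <;> fin_cases h <;>
    simp only [shift_eq, sgn, Fin.zero_eta, Fin.mk_one, Fin.isValue, Matrix.of_apply,
      Matrix.cons_val, Complex.ofReal_neg, Complex.ofReal_one] <;>
    field_simp <;>
    ring

theorem exists_eventually_one_add_le_norm_eig_sub_pole :
    ∃ M ≥ 1, ∀ᶠ k in atTop, ∀ ε η x, x ≠ (k, ε) →
      1 + |P.ω x.1 - P.ω k| ≤ M * ‖P.eig ν (k, ε, η) - P.pole x‖ := by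
  obtain ⟨g, hg, hgap⟩ := P.exists_pairwise_le_norm_pole_sub
  refine ⟨2 * (1 / g + 1), by linarith [one_div_pos.2 hg], ?_⟩
  filter_upwards [hν.eventually_norm_le (half_pos hg)] with k hk ε η x hx
  have hfar : ‖P.pole x - P.pole (k, ε)‖ ≤ 2 * ‖P.eig ν (k, ε, η) - P.pole x‖ := by
    have hnear : ‖P.eig ν (k, ε, η) - P.pole (k, ε)‖ = ‖ν k‖ := by
      rw [eig_eq, add_sub_cancel_left, norm_shift]
    have htri := norm_sub_le_norm_sub_add_norm_sub (P.pole x) (P.eig ν (k, ε, η)) (P.pole (k, ε))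
    rw [norm_sub_rev (P.pole x) (P.eig _ _)] at htri
    linarith [hgap hx]
  calc 1 + |P.ω x.1 - P.ω k|
      ≤ 1 / g * ‖P.pole x - P.pole (k, ε)‖ + ‖P.pole x - P.pole (k, ε)‖ := by
        refine add_le_add ?_ (P.abs_ω_sub_le_norm_pole_sub x (k, ε))
        rw [one_div_mul_eq_div, one_le_div hg]
        exact hgap hx
    _ = (1 / g + 1) * ‖P.pole x - P.pole (k, ε)‖ := by ring
    _ ≤ (1 / g + 1) * (2 * ‖P.eig ν (k, ε, η) - P.pole x‖) := by gcongr
    _ = 2 * (1 / g + 1) * ‖P.eig ν (k, ε, η) - P.pole x‖ := by ring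

theorem exists_eventually_norm_rieszVector_apply_le :
    ∃ K ≥ 2, ∀ᶠ k in atTop, ∀ h' ε' j h ε, (j, ε) ≠ (k, ε') →
      ‖P.rieszVector ν k (pairEquiv (h', ε')) j (pairEquiv (h, ε))‖
        ≤ K * (|P.b j| / (1 + |P.ω j - P.ω k|)) := by
  obtain ⟨M, hM, hdist⟩ := hν.exists_eventually_one_add_le_norm_eig_sub_pole
  refine ⟨5 * M ^ 2, by nlinarith, ?_⟩
  filter_upwards [hdist, hν.eventually_norm_eigenCoeff_le] with k hk hcoeff h' ε' j h ε hne
  have hterm (η : Fin 2) :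
      ‖P.eigenCoeff ν k h' ε' η * P.thetaSeq (P.eig ν (k, ε', η)) j (pairEquiv (h, ε))‖
        ≤ 5 / 2 * (M ^ 2 * (|P.b j| / (1 + |P.ω j - P.ω k|))) := by
    have hΔ : 1 ≤ 1 + |P.ω j - P.ω k| := by linarith [abs_nonneg (P.ω j - P.ω k)]
    have hD : 1 + |P.ω j - P.ω k| ≤ M * ‖P.eig ν (k, ε', η) - P.pole (j, ε)‖ :=
      hk ε' η (j, ε) hne
    have hpos : 0 < ‖P.eig ν (k, ε', η) - P.pole (j, ε)‖ :=
      pos_of_mul_pos_right (zero_lt_one.trans_le (hΔ.trans hD)) (by linarith)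
    have hpow : 1 + |P.ω j - P.ω k|
        ≤ M ^ 2 * ‖P.eig ν (k, ε', η) - P.pole (j, ε)‖ ^ ((h : ℕ) + 1) :=
      calc 1 + |P.ω j - P.ω k|
          ≤ (M * ‖P.eig ν (k, ε', η) - P.pole (j, ε)‖) ^ ((h : ℕ) + 1) :=
            (le_self_pow₀ hΔ h.val.succ_ne_zero).trans (by gcongr)
        _ ≤ M ^ 2 * ‖P.eig ν (k, ε', η) - P.pole (j, ε)‖ ^ ((h : ℕ) + 1) := by
            rw [mul_pow]
            gcongr
            omega
    rw [norm_mul, thetaSeq_pairEquiv, norm_div, norm_mul, norm_pow, Complex.norm_real,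
      Complex.norm_real, Real.norm_eq_abs, Real.norm_eq_abs, abs_sgn, one_mul]
    gcongr
    · exact hcoeff h' ε' η
    · rw [mul_div_assoc', div_le_div_iff₀ (by positivity) (by positivity)]
      nlinarith [abs_nonneg (P.b j)]
  rw [rieszVector_pairEquiv_apply, Fin.sum_univ_two]
  exact (norm_add_le _ _).trans ((add_le_add (hterm 0) (hterm 1)).trans_eq (by ring))

end IsLabelling

end Oscillator

namespace Oscillator.IsLabelling

open StateSpace

variable {P : Oscillator} {ν : ℕ → ℂ} (hν : P.IsLabelling ν)
include hν

theorem norm_rieszVector_sub_unit_apply_self_le (k : ℕ) (h' h ε : Fin 2) :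
    ‖(P.rieszVector ν k (pairEquiv (h', ε)) - unit (k, pairEquiv (h', ε))) k (pairEquiv (h, ε))‖
      ≤ ‖ν k‖ := by
  have hentry : (P.rieszVector ν k (pairEquiv (h', ε)) - unit (k, pairEquiv (h', ε))) k
      (pairEquiv (h, ε)) = !![0, 0; -(sgn ε * (ν k).im * Complex.I), 0] h' h := by
    rw [lp.coeFn_sub, Pi.sub_apply, PiLp.sub_apply, hν.rieszVector_pairEquiv_apply_self, unit_apply]
    fin_cases h' <;> fin_cases h <;> simp
  rw [hentry]
  fin_cases h' <;> fin_cases h <;> simp [abs_sgn, Complex.abs_im_le_norm]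

theorem exists_eventually_norm_rieszVector_sub_unit_apply_le :
    ∃ K ≥ 0, ∀ᶠ k in atTop, ∀ i j l, ‖(P.rieszVector ν k i - unit (k, i)) j l‖
      ≤ K * (|P.b j| / (1 + |P.ω j - P.ω k|)) := by
  obtain ⟨K, hK, hfar⟩ := hν.exists_eventually_norm_rieszVector_apply_le
  refine ⟨K, zero_le_two.trans hK, ?_⟩
  filter_upwards [hfar, hν.eventually_norm_le_abs_b] with k hk hbound i j l
  obtain ⟨⟨h', ε'⟩, rfl⟩ := pairEquiv.surjective i
  obtain ⟨⟨h, ε⟩, rfl⟩ := pairEquiv.surjective l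
  by_cases hne : (j, ε) = (k, ε')
  · obtain ⟨rfl, rfl⟩ := Prod.mk.inj hne
    calc _ ≤ ‖ν j‖ := hν.norm_rieszVector_sub_unit_apply_self_le j h' h ε
      _ ≤ 2 * |P.b j| := hbound.2.1
      _ ≤ K * |P.b j| := by gcongr
      _ = _ := by simp
  · have hunit : unit (k, pairEquiv (h', ε')) j (pairEquiv (h, ε)) = 0 := by
      rw [unit_apply, if_neg]
      intro heq
      obtain ⟨rfl, hl⟩ := Prod.mk.inj heq
      obtain ⟨-, rfl⟩ := Prod.mk.inj (pairEquiv.injective hl)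
      exact hne rfl
    rw [lp.coeFn_sub, Pi.sub_apply, PiLp.sub_apply, hunit, sub_zero]
    exact hk h' ε' j h ε hne

theorem exists_eventually_norm_rieszVector_sub_unit_apply_sq_le :
    ∃ K ≥ 0, ∀ᶠ k in atTop, ∀ i j, ‖(P.rieszVector ν k i - unit (k, i)) j‖ ^ 2
      ≤ K * (P.b j ^ 2 / (1 + |P.ω j - P.ω k|) ^ 2) := by
  obtain ⟨K, -, hbound⟩ := hν.exists_eventually_norm_rieszVector_sub_unit_apply_le
  refine ⟨4 * K ^ 2, by positivity, ?_⟩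
  filter_upwards [hbound] with k hk i j
  calc ‖(P.rieszVector ν k i - unit (k, i)) j‖ ^ 2
      ≤ ∑ _ : Fin 4, (K * (|P.b j| / (1 + |P.ω j - P.ω k|))) ^ 2 := by
        rw [EuclideanSpace.norm_sq_eq]
        gcongr with l
        exact hk i j l
    _ = 4 * K ^ 2 * (P.b j ^ 2 / (1 + |P.ω j - P.ω k|) ^ 2) := by
        rw [Fin.sum_const, mul_pow, div_pow, sq_abs, nsmul_eq_mul]
        push_cast
        ring

end Oscillator.IsLabelling

theorem hasSum_of_hasSum_sum {α β E : Type*} [Fintype β] [NormedAddCommGroup E] {f : α × β → E}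
    {s : E} (hf : Summable f) (h : HasSum (fun k => ∑ i, f (k, i)) s) : HasSum f s := by
  rw [← (hf.hasSum.prod_fiberwise fun k => hasSum_fintype fun i => f (k, i)).unique h]
  exact hf.hasSum

namespace Oscillator

variable {P : Oscillator}

/-- The coordinates with respect to the eigenvectors `theta (eig ν n)` of the combination of Riesz
vectors with coefficients `a`. -/
noncomputable def eigenCoord (P : Oscillator) (ν : ℕ → ℂ) (a : StateSpace)
    (n : ℕ × Fin 2 × Fin 2) : ℂ :=
  ∑ h, a n.1 (pairEquiv (h, n.2.1)) * P.eigenCoeff ν n.1 h n.2.1 n.2.2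

theorem sum_smul_rieszVector (ν : ℕ → ℂ) (a : StateSpace) (k : ℕ) :
    ∑ i, a k i • P.rieszVector ν k i
      = ∑ y, P.eigenCoord ν a (k, y) • P.theta (P.eig ν (k, y)) := by
  rw [← pairEquiv.sum_comp, Fintype.sum_prod_type_right, Fintype.sum_prod_type]
  refine Finset.sum_congr rfl fun ε _ => ?_
  simp only [rieszVector_pairEquiv, Finset.smul_sum, eigenCoord, Finset.sum_smul, smul_smul]
  exact Finset.sum_comm

namespace IsLabelling

variable {ν : ℕ → ℂ} (hν : P.IsLabelling ν)
include hν

theorem eq_zero_of_eigenCoord_eq_zero {a : StateSpace} (ha : P.eigenCoord ν a = 0) : a = 0 := by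
  refine ext_pairEquiv fun ⟨k, ε⟩ h => ?_
  have hre : ((ν k).re : ℂ) ≠ 0 := Complex.ofReal_ne_zero.2 (hν.re_ne_zero k)
  have hcombination (η : Fin 2) :
      a k (pairEquiv (0, ε)) * (sgn η / (ν k).re) + a k (pairEquiv (1, ε)) = 0 := by
    have hfactor : (sgn ε * (shift ν k ε η ^ 2 / (2 * P.b k)) : ℂ) ≠ 0 :=
      mul_ne_zero (Complex.ofReal_ne_zero.2 (sgn_ne_zero ε)) <|
        div_ne_zero (pow_ne_zero 2 (hν.shift_ne_zero k ε η)) <|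
          mul_ne_zero two_ne_zero (P.ofReal_b_ne_zero k)
    have hzero : P.eigenCoord ν a (k, ε, η) = 0 := congrFun ha _
    rw [eigenCoord, Fin.sum_univ_two] at hzero
    refine mul_left_cancel₀ hfactor (Eq.trans ?_ (hzero.trans (mul_zero _).symm))
    simp only [eigenCoeff, Matrix.cons_val_zero, Matrix.cons_val_one]
    ring
  have h₀ := hcombination 0
  have h₁ := hcombination 1
  simp only [sgn, Matrix.cons_val_zero, Matrix.cons_val_one] at h₀ h₁
  push_cast at h₀ h₁
  have hlow : a k (pairEquiv (0, ε)) = 0 := by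
    field_simp at h₀ h₁
    linear_combination (h₀ - h₁) / 2
  have hhigh : a k (pairEquiv (1, ε)) = 0 := by linear_combination (h₀ + h₁) / 2
  fin_cases h <;> assumption

theorem eventually_norm_eigenCoord_le (a : StateSpace) :
    ∀ᶠ k in atTop, ∀ y, ‖P.eigenCoord ν a (k, y)‖ ≤ 5 * ‖a k‖ := by
  filter_upwards [hν.eventually_norm_eigenCoeff_le] with k hk y
  calc ‖P.eigenCoord ν a (k, y)‖ ≤ ∑ _ : Fin 2, ‖a k‖ * (5 / 2) := by
        refine norm_sum_le_of_le _ fun h _ => ?_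
        rw [norm_mul]
        exact mul_le_mul (PiLp.norm_apply_le _ _) (hk h _ _) (norm_nonneg _) (norm_nonneg _)
    _ = 5 * ‖a k‖ := by
        rw [Fin.sum_univ_two]
        ring

theorem exists_eventually_mul_le_norm_eig :
    ∃ g > 0, ∀ᶠ k : ℕ in atTop, ∀ y, g * k ≤ 1 + ‖P.eig ν (k, y)‖ := by
  obtain ⟨g, hg, hgap⟩ := P.exists_forall_mul_abs_sub_le_abs_ω_sub
  refine ⟨g, hg, ?_⟩
  filter_upwards [hν.eventually_norm_le one_pos] with k hk y
  have hω : g * k ≤ P.ω k := by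
    have hle := hgap k 0
    rw [Nat.cast_zero, sub_zero, Nat.abs_cast, abs_of_nonneg (sub_nonneg.2 (P.ω_zero_le k))] at hle
    linarith [P.ω_pos]
  have hnear := norm_le_add_norm_add (P.pole (k, y.1)) (shift ν k y.1 y.2)
  rw [← eig_eq, norm_shift, norm_pole] at hnear
  exact hω.trans (by linarith)

theorem tendsto_norm_eig : Tendsto (fun n => ‖P.eig ν n‖) cofinite atTop := by
  obtain ⟨g, hg, hle⟩ := hν.exists_eventually_mul_le_norm_eig
  have hfst : Tendsto (fun n : ℕ × Fin 2 × Fin 2 => g * n.1 - 1) cofinite atTop := by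
    refine tendsto_atTop_add_const_right _ _ (Tendsto.const_mul_atTop hg ?_)
    refine tendsto_natCast_atTop_atTop.comp (tendsto_atTop.2 fun m => ?_)
    exact eventually_cofinite_fst (eventually_ge_atTop m)
  refine tendsto_atTop_mono' _ ?_ hfst
  filter_upwards [eventually_cofinite_fst hle] with n hn
  linarith [hn n.2]

theorem summable_norm_eigenCoord_div (a : StateSpace) :
    Summable fun n => ‖P.eigenCoord ν a n‖ / (1 + ‖P.eig ν n‖) := by
  obtain ⟨g, hg, hle⟩ := hν.exists_eventually_mul_le_norm_eig
  have hmajorant : Summable fun k : ℕ => 5 / g * (‖a k‖ ^ 2 + (1 / (k : ℝ)) ^ 2) := by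
    simp only [one_div_pow]
    exact ((StateSpace.hasSum_norm_sq a).summable.add
      (Real.summable_one_div_nat_pow.2 one_lt_two)).mul_left _
  refine summable_prod_of_eventually_norm_le hmajorant ?_
  filter_upwards [hle, hν.eventually_norm_eigenCoord_le a, eventually_gt_atTop 0]
    with k hk hcoord hpos y
  have hk₀ : (0 : ℝ) < k := Nat.cast_pos.2 hpos
  calc ‖‖P.eigenCoord ν a (k, y)‖ / (1 + ‖P.eig ν (k, y)‖)‖
      = ‖P.eigenCoord ν a (k, y)‖ / (1 + ‖P.eig ν (k, y)‖) := Real.norm_of_nonneg (by positivity)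
    _ ≤ 5 * ‖a k‖ / (g * k) := by gcongr; exacts [hcoord y, hk y]
    _ = 5 / g * (‖a k‖ * (1 / k)) := by field_simp
    _ ≤ 5 / g * (‖a k‖ ^ 2 + (1 / (k : ℝ)) ^ 2) := by
        gcongr
        nlinarith [sq_nonneg (‖a k‖ - 1 / k), sq_nonneg ‖a k‖, sq_nonneg (1 / (k : ℝ))]

theorem hasSum_eigenCoord_div {a : StateSpace}
    (ha : HasSum (fun x : ℕ × Fin 4 => a x.1 x.2 • P.rieszVector ν x.1 x.2) 0)
    (x : ℕ × Fin 2) (h : Fin 2) :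
    HasSum (fun n => P.eigenCoord ν a n / (P.eig ν n - P.pole x) ^ ((h : ℕ) + 1)) 0 := by
  have hsummable : Summable fun n =>
      P.eigenCoord ν a n / (P.eig ν n - P.pole x) ^ ((h : ℕ) + 1) := by
    refine .of_norm ((summable_norm_div_sub_pow hν.tendsto_norm_eig
      (hν.summable_norm_eigenCoord_div a) (z := P.pole x)
      (fun n => (hν.isEigenvalue_eig n).ne_pole x) h).congr fun n => ?_)
    rw [norm_div, norm_div, norm_pow, norm_pow, norm_sub_rev]
  refine hasSum_of_hasSum_sum hsummable ?_
  have hcoord := (ha.prod_fiberwise fun k => hasSum_fintype _).mapL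
    (innerSL ℂ (StateSpace.unit (x.1, pairEquiv (h, x.2))))
  rw [map_zero] at hcoord
  have hfactor : (sgn x.2 * P.b x.1 : ℂ) ≠ 0 :=
    mul_ne_zero (Complex.ofReal_ne_zero.2 (sgn_ne_zero _)) (P.ofReal_b_ne_zero _)
  rw [← hasSum_mul_left_iff hfactor, mul_zero]
  refine hcoord.congr_fun fun k => ?_
  rw [P.sum_smul_rieszVector, innerSL_apply_apply, inner_sum, Finset.mul_sum]
  refine Finset.sum_congr rfl fun y _ => ?_
  rw [inner_smul_right, StateSpace.inner_unit]
  change _ = _ * P.thetaSeq (P.eig ν (k, y)) x.1 (pairEquiv (h, x.2))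
  rw [thetaSeq_pairEquiv]
  ring

theorem eq_zero_of_hasSum_smul_rieszVector {a : StateSpace}
    (ha : HasSum (fun x : ℕ × Fin 4 => a x.1 x.2 • P.rieszVector ν x.1 x.2) 0) : a = 0 := by
  obtain ⟨g, hg, hgap⟩ := P.exists_pairwise_le_norm_pole_sub
  refine hν.eq_zero_of_eigenCoord_eq_zero ?_
  exact eq_zero_of_hasSum_div_sub_pow_eq_zero hg hgap (fun x => (P.pole_re x).le)
    P.summable_norm_b_sq hν.eig_injective hν.tendsto_norm_eig (hν.summable_norm_eigenCoord_div a)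
    (fun n x => (hν.isEigenvalue_eig n).ne_pole x) two_ne_zero
    (fun n => (hν.isEigenvalue_eig n).doublePoleSum_eq_two)
    (fun x => by simpa using hν.hasSum_eigenCoord_div ha x 0)
    (fun x => hν.hasSum_eigenCoord_div ha x 1)

end IsLabelling

open StateSpace

variable {ν : ℕ → ℂ} {ρ : ℝ}

theorem A4.a5_zero (hA4 : P.A4) : P.A5 0 := by
  simpa [A4, A5] using hA4

variable (P) in
theorem exists_diagonal (hρ : 0 ≤ ρ) : ∃ D : StateSpace →L[ℂ] StateSpace,
    ∀ a k, D a k = ((|P.b k| ^ ρ : ℝ) : ℂ) • a k := by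
  obtain ⟨B, hB⟩ := P.tendsto_abs_b.bddAbove_range
  have hbound (k : ℕ) : |P.b k| ≤ B := hB ⟨k, rfl⟩
  have hB₀ : 0 ≤ B := (abs_nonneg _).trans (hbound 0)
  refine ⟨lp.mapCLM 2 (fun k => ((|P.b k| ^ ρ : ℝ) : ℂ) • ContinuousLinearMap.id ℂ _)
    (K := B ^ ρ) (by positivity) fun k => ?_, fun a k => rfl⟩
  refine (norm_smul_le _ _).trans ?_
  rw [Complex.norm_of_nonneg (by positivity)]
  exact (mul_le_of_le_one_right (by positivity) ContinuousLinearMap.norm_id_le).trans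
    (Real.rpow_le_rpow (abs_nonneg _) (hbound k) hρ)

theorem rpow_two_mul_abs_b (k : ℕ) : |P.b k| ^ (2 * ρ) = (|P.b k| ^ ρ) ^ 2 := by
  rw [mul_comm, Real.rpow_mul (abs_nonneg _), Real.rpow_two]

theorem sq_weight_mul_le (ρ : ℝ) (j k : ℕ) :
    (|P.b j| ^ ρ / |P.b k| ^ ρ) ^ 2 * (P.b j ^ 2 / (1 + |P.ω j - P.ω k|) ^ 2)
      ≤ (if j = k then P.b k ^ 2 else 0) + if j = k then 0 else
        1 / |P.b k| ^ (2 * ρ) * (|P.b j| ^ (2 * (1 + ρ)) / (P.ω j - P.ω k) ^ 2) := by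
  have hb := P.abs_b_pos
  split_ifs with hjk
  · have hk : |P.b k| ^ ρ ≠ 0 := (Real.rpow_pos_of_pos (hb k) ρ).ne'
    simp [hjk, hk]
  · obtain ⟨g, hg, hgap⟩ := P.exists_forall_mul_abs_sub_le_abs_ω_sub
    have hω : 0 < |P.ω j - P.ω k| :=
      (mul_pos hg (abs_pos.2 (sub_ne_zero.2 (Nat.cast_injective.ne hjk)))).trans_le (hgap j k)
    have hrpow : |P.b j| ^ (2 * (1 + ρ)) = P.b j ^ 2 * (|P.b j| ^ ρ) ^ 2 := by
      rw [rpow_two_mul_abs_b, Real.rpow_add (hb j), Real.rpow_one, mul_pow, sq_abs]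
    calc _ ≤ (|P.b j| ^ ρ / |P.b k| ^ ρ) ^ 2 * (P.b j ^ 2 / |P.ω j - P.ω k| ^ 2) := by
          gcongr
          linarith
      _ = _ := by
          rw [zero_add, hrpow, rpow_two_mul_abs_b, sq_abs]
          ring

section Diagonal

variable {D : StateSpace →L[ℂ] StateSpace} (hD : ∀ a k, D a k = ((|P.b k| ^ ρ : ℝ) : ℂ) • a k)
include hD

theorem norm_smul_diagonal_apply (a : StateSpace) (j k : ℕ) :
    ‖(((|P.b k| ^ (-ρ) : ℝ) : ℂ) • D a) j‖ = |P.b j| ^ ρ / |P.b k| ^ ρ * ‖a j‖ := by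
  rw [lp.coeFn_smul, Pi.smul_apply, hD, norm_smul, norm_smul,
    Complex.norm_of_nonneg (by positivity), Complex.norm_of_nonneg (by positivity),
    Real.rpow_neg (abs_nonneg _), div_eq_inv_mul, mul_assoc]

theorem smul_diagonal_unit (x : ℕ × Fin 4) :
    ((|P.b x.1| ^ (-ρ) : ℝ) : ℂ) • D (unit x) = unit x := by
  ext j l
  rw [lp.coeFn_smul, Pi.smul_apply, hD, smul_smul, PiLp.smul_apply, ← Prod.mk.eta (p := x),
    unit_apply]
  split_ifs with hx
  · obtain ⟨rfl, -⟩ := Prod.mk.inj hx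
    rw [← Complex.ofReal_mul, ← Real.rpow_add (P.abs_b_pos _), neg_add_cancel, Real.rpow_zero,
      Complex.ofReal_one, one_smul]
  · exact smul_zero _

theorem denseRange_diagonal : DenseRange D := by
  have hspan : Submodule.span ℂ (Set.range basis) ≤ LinearMap.range D.toLinearMap := by
    rw [Submodule.span_le]
    rintro _ ⟨x, rfl⟩
    rw [basis_apply]
    exact ⟨_, (map_smul D _ _).trans (smul_diagonal_unit hD x)⟩
  exact (Submodule.dense_iff_topologicalClosure_eq_top.2 basis.dense_span).mono hspan

theorem IsLabelling.exists_eventually_norm_smul_diagonal_sub_unit_sq_le (hν : P.IsLabelling ν)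
    (hA5 : P.A5 ρ) : ∃ K, ∀ᶠ k in atTop, ∀ i,
      ‖((|P.b k| ^ (-ρ) : ℝ) : ℂ) • D (P.rieszVector ν k i) - unit (k, i)‖ ^ 2
        ≤ K * (P.b k ^ 2 + ∑' j, if j = k then 0 else
          1 / |P.b k| ^ (2 * ρ) * (|P.b j| ^ (2 * (1 + ρ)) / (P.ω j - P.ω k) ^ 2)) := by
  obtain ⟨K, hK, hentry⟩ := hν.exists_eventually_norm_rieszVector_sub_unit_apply_sq_le
  refine ⟨K, ?_⟩
  filter_upwards [hentry] with k hk i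
  have hdiff : ((|P.b k| ^ (-ρ) : ℝ) : ℂ) • D (P.rieszVector ν k i) - unit (k, i)
      = ((|P.b k| ^ (-ρ) : ℝ) : ℂ) • D (P.rieszVector ν k i - unit (k, i)) := by
    rw [map_sub, smul_sub, smul_diagonal_unit hD (k, i)]
  rw [hdiff]
  refine hasSum_le (fun j => ?_) (hasSum_norm_sq _)
    (((hasSum_ite_eq k (P.b k ^ 2)).add (hA5.prod_factor k).hasSum).mul_left K)
  rw [norm_smul_diagonal_apply hD, mul_pow]
  calc _ ≤ (|P.b j| ^ ρ / |P.b k| ^ ρ) ^ 2 * (K * (P.b j ^ 2 / (1 + |P.ω j - P.ω k|) ^ 2)) := by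
        gcongr
        exact hk i j
    _ = K * ((|P.b j| ^ ρ / |P.b k| ^ ρ) ^ 2 * (P.b j ^ 2 / (1 + |P.ω j - P.ω k|) ^ 2)) :=
        mul_left_comm _ _ _
    _ ≤ _ := by
        gcongr
        exact sq_weight_mul_le ρ j k

theorem IsLabelling.exists_diagonal_synthesis (hν : P.IsLabelling ν) (hA5 : P.A5 ρ) :
    ∃ T : StateSpace →L[ℂ] StateSpace,
      (∀ a, HasSum (fun x : ℕ × Fin 4 =>
        a x.1 x.2 • ((|P.b x.1| ^ (-ρ) : ℝ) : ℂ) • D (P.rieszVector ν x.1 x.2)) (T a)) ∧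
      (Function.Injective T ∨ DenseRange T → IsUnit T) := by
  obtain ⟨K, hle⟩ := hν.exists_eventually_norm_smul_diagonal_sub_unit_sq_le hD hA5
  have hsummable : Summable fun x : ℕ × Fin 4 =>
      ‖((|P.b x.1| ^ (-ρ) : ℝ) : ℂ) • D (P.rieszVector ν x.1 x.2) - basis x‖ ^ 2 := by
    refine summable_prod_of_eventually_norm_le ((P.summable_sq.add hA5.prod).mul_left K) ?_
    filter_upwards [hle] with k hk i
    rw [Real.norm_of_nonneg (sq_nonneg _), basis_apply]
    exact hk i
  simpa only [basis_repr_apply] using exists_synthesis_of_summable_norm_sub_sq basis hsummable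

end Diagonal

theorem IsLabelling.exists_isSynthesis (hν : P.IsLabelling ν) (hA4 : P.A4) :
    ∃ π₀ : StateSpace ≃L[ℂ] StateSpace, P.IsSynthesis ν π₀ := by
  obtain ⟨T, hT, hunit⟩ := hν.exists_diagonal_synthesis
    (D := ContinuousLinearMap.id ℂ StateSpace) (fun a k => by simp) hA4.a5_zero
  have hsynthesis (a : StateSpace) :
      HasSum (fun x : ℕ × Fin 4 => a x.1 x.2 • P.rieszVector ν x.1 x.2) (T a) := by
    simpa using hT a
  have hinj : Function.Injective T := (injective_iff_map_eq_zero T).2 fun a ha =>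
    hν.eq_zero_of_hasSum_smul_rieszVector (ha ▸ hsynthesis a)
  obtain ⟨u, rfl⟩ := hunit (.inl hinj)
  exact ⟨.ofUnit u, hsynthesis⟩

theorem IsLabelling.exists_diagonal_conj (hν : P.IsLabelling ν) (hA5 : P.A5 ρ)
    {D : StateSpace →L[ℂ] StateSpace} (hD : ∀ a k, D a k = ((|P.b k| ^ ρ : ℝ) : ℂ) • a k)
    {π₀ : StateSpace ≃L[ℂ] StateSpace} (hπ₀ : P.IsSynthesis ν π₀) :
    ∃ S : StateSpace ≃L[ℂ] StateSpace, ∀ a, S (D a) = D (π₀ a) := by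
  obtain ⟨T, hT, hunit⟩ := hν.exists_diagonal_synthesis hD hA5
  have hconj (a : StateSpace) : T (D a) = D (π₀ a) := by
    refine (hT (D a)).unique (((hπ₀ a).mapL D).congr_fun fun x => ?_)
    rw [map_smul, smul_smul, hD, PiLp.smul_apply, smul_eq_mul, mul_right_comm,
      ← Complex.ofReal_mul, ← Real.rpow_add (P.abs_b_pos _), add_neg_cancel, Real.rpow_zero,
      Complex.ofReal_one, one_mul]
  have hdense : DenseRange T := by
    refine (denseRange_diagonal hD).mono ?_
    rintro _ ⟨a, rfl⟩
    exact ⟨D (π₀.symm a), by rw [hconj, π₀.apply_symm_apply]⟩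
  obtain ⟨u, rfl⟩ := hunit (.inr hdense)
  exact ⟨.ofUnit u, hconj⟩

namespace WeightedSpace

theorem W_surjective {γ : ℝ} : Function.Surjective (W : P.WeightedSpace γ →ₗ[ℂ] StateSpace) := by
  intro a
  have hcancel (k : ℕ) :
      ((|P.b k| ^ (-γ) : ℝ) : ℂ) • ((|P.b k| ^ (-γ) : ℝ) : ℂ)⁻¹ • a k = a k :=
    smul_inv_smul₀ (Complex.ofReal_ne_zero.2 (Real.rpow_pos_of_pos (P.abs_b_pos k) _).ne') _
  refine ⟨⟨fun k => ((|P.b k| ^ (-γ) : ℝ) : ℂ)⁻¹ • a k, ?_⟩, ?_⟩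
  · change Memℓp (fun k => _) 2
    simp only [hcancel]
    exact lp.memℓp a
  · ext k : 2
    exact hcancel k

/-- The isometric isomorphism `W` of a weighted space onto the state space. -/
noncomputable def equiv (P : Oscillator) (γ : ℝ) : P.WeightedSpace γ ≃ₗᵢ[ℂ] StateSpace :=
  .ofSurjective ⟨W, fun _ => rfl⟩ W_surjective

theorem val_equiv_symm_diagonal {D : StateSpace →L[ℂ] StateSpace}
    (hD : ∀ a k, D a k = ((|P.b k| ^ ρ : ℝ) : ℂ) • a k) (a : StateSpace) :
    ((equiv P (-ρ)).symm (D a)).val = a := by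
  funext k
  have hW : W ((equiv P (-ρ)).symm (D a)) k = D a k :=
    congrFun (congrArg _ ((equiv P (-ρ)).apply_symm_apply (D a))) k
  rw [W_apply, neg_neg, hD] at hW
  exact smul_right_injective _
    (Complex.ofReal_ne_zero.2 (Real.rpow_pos_of_pos (P.abs_b_pos k) _).ne') hW

end WeightedSpace

end Oscillator

theorem mainTheorem4 (P : Oscillator) (hA4 : P.A4) (ρ : ℝ) (hρ : 0 < ρ) (hA5 : P.A5 ρ)
    (ν : ℕ → ℂ) (hν : P.IsLabelling ν) :
    ∃ π₀ : StateSpace ≃L[ℂ] StateSpace, P.IsSynthesis ν π₀ ∧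
      ∃ T : P.WeightedSpace (-ρ) ≃L[ℂ] P.WeightedSpace (-ρ),
        ∀ a : StateSpace, ∃ v : P.WeightedSpace (-ρ),
          v.val = (a : ℕ → EuclideanSpace ℂ (Fin 4)) ∧
          (T v).val = (π₀ a : ℕ → EuclideanSpace ℂ (Fin 4)) := by
  obtain ⟨π₀, hπ₀⟩ := hν.exists_isSynthesis hA4
  obtain ⟨D, hD⟩ := P.exists_diagonal hρ.le
  obtain ⟨S, hS⟩ := hν.exists_diagonal_conj hA5 hD hπ₀
  let E := (Oscillator.WeightedSpace.equiv P (-ρ)).toContinuousLinearEquiv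
  refine ⟨π₀, hπ₀, (E.trans S).trans E.symm, fun a =>
    ⟨E.symm (D a), Oscillator.WeightedSpace.val_equiv_symm_diagonal hD a, ?_⟩⟩
  rw [ContinuousLinearEquiv.trans_apply, ContinuousLinearEquiv.trans_apply, E.apply_symm_apply, hS]
  exact Oscillator.WeightedSpace.val_equiv_symm_diagonal hD (π₀ a)
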